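/- Let $k\ge 0$, let $S_k$ be the symmetric group with its Bruhat order $\le$, and let $w_0\in S_k$ be its longest element. Let $\mathcal{F}\ell_k=\mathrm{GL}_k(\mathbb{C})/\mathsf{B}$ (with $\mathsf{B}$ the upper triangular matrices) be the variety of complete flags in $\mathbb{C}^k$. For $w\in S_k$ let $\mathcal{F}(w)$ be the coordinate flag whose $i$-th subspace is $\langle e_{w(1)},\dots,e_{w(i)}\rangle$, and put $\mathcal{F}^{\mathrm{std}}=\mathcal{F}(e)$, $\mathcal{F}^{\mathrm{ant}}=\mathcal{F}(w_0)$. Write $\mathcal{F}\xrightarrow{w}\mathcal{F}'$ if there is $g\in\mathrm{GL}_k(\mathbb{C})$ with $g\mathcal{F}=\mathcal{F}^{\mathrm{std}}$ and $g\mathcal{F}'=\mathcal{F}(w)$; the flags are transverse if $\mathcal{F}\xrightarrow{w_0}\mathcal{F}'$. For $u,v,w\in S_k$ define the (possibly empty) locally closed subvarieties $$R(u,w)=\{\mathcal{F}\in\mathcal{F}\ell_k \mid \mathcal{F}^{\mathrm{std}}\xrightarrow{w}\mathcal{F}\xrightarrow{u^{-1}w_0}\mathcal{F}^{\mathrm{ant}}\},\qquad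 \mathcal{U}_{u,v,w}=\{\mathcal{F}\in R(u,w)\mid \mathcal{F}\xrightarrow{w_0}\mathcal{F}(vw_0)\}.$$ **Theorem.** If $u\le v\le w$ in $S_k$, then $\mathcal{U}_{u,v,w}$ is principal open in $R(u,w)$, i.e. it is the nonvanishing locus of a regular function on $R(u,w)$, and there is an isomorphism of algebraic varieties $$\mathcal{U}_{u,v,w}\cong R(u,v)\times R(v,w).$$ Conversely, if $u,v,w\in S_k$ and $\mathcal{U}_{u,v,w}\neq\emptyset$, then $u\le v\le w$. -/

import Mathlib

noncomputable section

open scoped Topology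

namespace SplicedFlags

/-! ### Spaces with functions

Complex algebraic varieties are treated in the classical way, as sets of points with a Zariski
topology and, on every open set, an algebra of regular complex-valued functions. -/

/-- A space with functions on the set `X`: a topology together with, for each open set `U`, an
algebra of `ℂ`-valued functions on `U` called regular. The regular functions form a sheaf, the
nonvanishing locus of a regular function is open and its inverse is regular there.
A function on `U` is represented by any function on `X` that restricts to it; by `congr` only
the values on `U` matter. -/
structure FunSpace (X : Type) where
  /-- the Zariski topology -/
  top : TopologicalSpace X
  /-- `IsReg U f`: the restriction of `f` to the open set `U` is a regular function on `U` -/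
  IsReg : Set X → (X → ℂ) → Prop
  congr : ∀ {U : Set X} {f g : X → ℂ}, Set.EqOn f g U → IsReg U f → IsReg U g
  const : ∀ (U : Set X) (c : ℂ), IsReg U (fun _ => c)
  add : ∀ {U : Set X} {f g : X → ℂ}, IsReg U f → IsReg U g → IsReg U (f + g)
  mul : ∀ {U : Set X} {f g : X → ℂ}, IsReg U f → IsReg U g → IsReg U (f * g)
  mono : ∀ {U V : Set X} {f : X → ℂ}, IsOpen[top] V → V ⊆ U → IsReg U f → IsReg V f
  glue : ∀ {U : Set X} {f : X → ℂ},
    (∀ x ∈ U, ∃ V, IsOpen[top] V ∧ x ∈ V ∧ V ⊆ U ∧ IsReg V f) → IsReg U f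
  isOpen_ne : ∀ {U : Set X} {f : X → ℂ}, IsOpen[top] U → IsReg U f →
    IsOpen[top] {x | x ∈ U ∧ f x ≠ 0}
  inv : ∀ {U : Set X} {f : X → ℂ}, IsOpen[top] U → IsReg U f →
    IsReg {x | x ∈ U ∧ f x ≠ 0} f⁻¹

namespace FunSpace

variable {X Y : Type}

/-- Morphisms: continuous maps that pull regular functions back to regular functions. -/
def IsMorphism (A : FunSpace X) (B : FunSpace Y) (φ : X → Y) : Prop :=
  ∀ V : Set Y, IsOpen[B.top] V →
    IsOpen[A.top] (φ ⁻¹' V) ∧ ∀ g : Y → ℂ, B.IsReg V g → A.IsReg (φ ⁻¹' V) (g ∘ φ)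

/-- Two spaces with functions are isomorphic: there is a bijection which is a morphism in both
directions. -/
def Isomorphic (A : FunSpace X) (B : FunSpace Y) : Prop :=
  ∃ φ : X ≃ Y, A.IsMorphism B φ ∧ B.IsMorphism A φ.symm

/-- `S` is a principal open subset: the nonvanishing locus of one globally regular function. -/
def IsPrincipalOpen (A : FunSpace X) (S : Set X) : Prop :=
  ∃ f : X → ℂ, A.IsReg Set.univ f ∧ S = {x | f x ≠ 0}

/-- Affine space `ℂ^σ`. The sets `{q ≠ 0}`, for `q` a polynomial, form a base of the topology, and
the regular functions are those that are locally quotients of polynomials. -/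
def affine (σ : Type) : FunSpace (σ → ℂ) where
  top :=
    { IsOpen := fun W => ∀ x ∈ W, ∃ q : MvPolynomial σ ℂ, MvPolynomial.eval x q ≠ 0 ∧
        ∀ y, MvPolynomial.eval y q ≠ 0 → y ∈ W
      isOpen_univ := fun x _ => ⟨1, by simp, fun y _ => trivial⟩
      isOpen_inter := by
        intro s t hs ht x hx
        obtain ⟨p, hp, hp'⟩ := hs x hx.1
        obtain ⟨q, hq, hq'⟩ := ht x hx.2
        refine ⟨p * q, by simp [hp, hq], fun y hy => ?_⟩
        simp only [map_mul, ne_eq, mul_eq_zero, not_or] at hy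
        exact ⟨hp' y hy.1, hq' y hy.2⟩
      isOpen_sUnion := by
        intro S hS x ⟨t, ht, hx⟩
        obtain ⟨q, hq, hq'⟩ := hS t ht x hx
        exact ⟨q, hq, fun y hy => ⟨t, ht, hq' y hy⟩⟩ }
  IsReg := fun U f => ∀ x ∈ U, ∃ p q : MvPolynomial σ ℂ, MvPolynomial.eval x q ≠ 0 ∧
    ∀ y ∈ U, MvPolynomial.eval y q ≠ 0 → f y = MvPolynomial.eval y p / MvPolynomial.eval y q
  congr := by
    intro U f g h hf x hx
    obtain ⟨p, q, hq, H⟩ := hf x hx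
    exact ⟨p, q, hq, fun y hy hqy => (h hy) ▸ H y hy hqy⟩
  const := fun U c x _ => ⟨MvPolynomial.C c, 1, by simp, by simp⟩
  add := by
    intro U f g hf hg x hx
    obtain ⟨p, q, hq, H⟩ := hf x hx
    obtain ⟨p', q', hq', H'⟩ := hg x hx
    refine ⟨p * q' + q * p', q * q', by simp [hq, hq'], fun y hy hqy => ?_⟩
    simp only [map_mul, ne_eq, mul_eq_zero, not_or] at hqy
    simp only [Pi.add_apply, map_mul, map_add, H y hy hqy.1, H' y hy hqy.2]
    rw [div_add_div _ _ hqy.1 hqy.2]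
  mul := by
    intro U f g hf hg x hx
    obtain ⟨p, q, hq, H⟩ := hf x hx
    obtain ⟨p', q', hq', H'⟩ := hg x hx
    refine ⟨p * p', q * q', by simp [hq, hq'], fun y hy hqy => ?_⟩
    simp only [map_mul, ne_eq, mul_eq_zero, not_or] at hqy
    simp only [Pi.mul_apply, map_mul, H y hy hqy.1, H' y hy hqy.2]
    rw [div_mul_div_comm]
  mono := by
    intro U V f _ hVU hf x hx
    obtain ⟨p, q, hq, H⟩ := hf x (hVU hx)
    exact ⟨p, q, hq, fun y hy => H y (hVU hy)⟩
  glue := by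
    intro U f h x hx
    obtain ⟨V, hV, hxV, hVU, hf⟩ := h x hx
    obtain ⟨p, q, hq, H⟩ := hf x hxV
    obtain ⟨r, hr, hrV⟩ := hV x hxV
    refine ⟨p * r, q * r, by simp [hq, hr], fun y hy hqy => ?_⟩
    simp only [map_mul, ne_eq, mul_eq_zero, not_or] at hqy
    simp only [map_mul, H y (hrV y hqy.2) hqy.1]
    rw [mul_div_mul_right _ _ hqy.2]
  isOpen_ne := by
    intro U f hU hf x hx
    obtain ⟨p, q, hq, H⟩ := hf x hx.1
    obtain ⟨r, hr, hrU⟩ := hU x hx.1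
    have hp : MvPolynomial.eval x p ≠ 0 := fun h0 => hx.2 (by simp [H x hx.1 hq, h0])
    refine ⟨p * q * r, by simp [hp, hq, hr], fun y hy => ?_⟩
    simp only [map_mul, ne_eq, mul_eq_zero, not_or] at hy
    have hyU := hrU y hy.2
    exact ⟨hyU, by rw [H y hyU hy.1.2]; exact div_ne_zero hy.1.1 hy.1.2⟩
  inv := by
    intro U f _ hf x hx
    obtain ⟨p, q, hq, H⟩ := hf x hx.1
    have hp : MvPolynomial.eval x p ≠ 0 := fun h0 => hx.2 (by simp [H x hx.1 hq, h0])
    refine ⟨q * q, p * q, by simp [hp, hq], fun y hy hqy => ?_⟩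
    simp only [map_mul, ne_eq, mul_eq_zero, not_or] at hqy
    simp only [Pi.inv_apply, map_mul, H y hy.1 hqy.2]
    rw [inv_div, mul_div_mul_right _ _ hqy.2]

/-- The structure induced along a map `i : X → Y`, in practice the inclusion of a subset: the
induced topology, and the functions that are locally restrictions of regular functions on open
subsets of `Y`. For a locally closed subset of a variety this is the usual (reduced) structure of a
subvariety. -/
def induced (i : X → Y) (B : FunSpace Y) : FunSpace X where
  top := TopologicalSpace.induced i B.top
  IsReg := fun U f => ∀ x ∈ U, ∃ V : Set Y, IsOpen[B.top] V ∧ i x ∈ V ∧ ∃ g : Y → ℂ, B.IsReg V g ∧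
    ∀ y ∈ U, i y ∈ V → f y = g (i y)
  congr := by
    intro U f g h hf x hx
    obtain ⟨V, hV, hxV, e, he, H⟩ := hf x hx
    exact ⟨V, hV, hxV, e, he, fun y hy hyV => (h hy) ▸ H y hy hyV⟩
  const := fun U c x _ => ⟨Set.univ, B.top.isOpen_univ, trivial, fun _ => c, B.const _ _, by simp⟩
  add := by
    intro U f g hf hg x hx
    obtain ⟨V, hV, hxV, e, he, H⟩ := hf x hx
    obtain ⟨V', hV', hxV', e', he', H'⟩ := hg x hx
    have hVV := B.top.isOpen_inter V V' hV hV'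
    refine ⟨V ∩ V', hVV, ⟨hxV, hxV'⟩, e + e',
      B.add (B.mono hVV Set.inter_subset_left he) (B.mono hVV Set.inter_subset_right he'),
      fun y hy hyV => ?_⟩
    simp [H y hy hyV.1, H' y hy hyV.2]
  mul := by
    intro U f g hf hg x hx
    obtain ⟨V, hV, hxV, e, he, H⟩ := hf x hx
    obtain ⟨V', hV', hxV', e', he', H'⟩ := hg x hx
    have hVV := B.top.isOpen_inter V V' hV hV'
    refine ⟨V ∩ V', hVV, ⟨hxV, hxV'⟩, e * e',
      B.mul (B.mono hVV Set.inter_subset_left he) (B.mono hVV Set.inter_subset_right he'),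
      fun y hy hyV => ?_⟩
    simp [H y hy hyV.1, H' y hy hyV.2]
  mono := by
    intro U V f _ hVU hf x hx
    obtain ⟨V', hV', hxV', e, he, H⟩ := hf x (hVU hx)
    exact ⟨V', hV', hxV', e, he, fun y hy => H y (hVU hy)⟩
  glue := by
    intro U f h x hx
    obtain ⟨W, ⟨W', hW', rfl⟩, hxW, hWU, hf⟩ := h x hx
    obtain ⟨V, hV, hxV, e, he, H⟩ := hf x hxW
    have hVW := B.top.isOpen_inter V W' hV hW'
    exact ⟨V ∩ W', hVW, ⟨hxV, hxW⟩, e, B.mono hVW Set.inter_subset_left he,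
      fun y _ hyV => H y hyV.2 hyV.1⟩
  isOpen_ne := by
    intro U f hU hf
    let _ := TopologicalSpace.induced i B.top
    refine isOpen_iff_forall_mem_open.2 fun x hx => ?_
    obtain ⟨V, hV, hxV, e, he, H⟩ := hf x hx.1
    refine ⟨U ∩ i ⁻¹' {y | y ∈ V ∧ e y ≠ 0}, ?_, ?_, ?_⟩
    · rintro y ⟨hyU, hyV, hy⟩
      exact ⟨hyU, by rwa [H y hyU hyV]⟩
    · exact IsOpen.inter hU ⟨_, B.isOpen_ne hV he, rfl⟩
    · exact ⟨hx.1, hxV, by rw [← H x hx.1 hxV]; exact hx.2⟩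
  inv := by
    intro U f _ hf x hx
    obtain ⟨V, hV, hxV, e, he, H⟩ := hf x hx.1
    refine ⟨{y | y ∈ V ∧ e y ≠ 0}, B.isOpen_ne hV he,
      ⟨hxV, by rw [← H x hx.1 hxV]; exact hx.2⟩, e⁻¹, B.inv hV he, fun y hy hyV => ?_⟩
    simp [H y hy.1 hyV.1]

/-- The quotient structure along a map `π : X → Y`, in practice surjective: a set is open if its
preimage is, and a function is regular if its pullback is. -/
def quotient (π : X → Y) (A : FunSpace X) : FunSpace Y where
  top := TopologicalSpace.coinduced π A.top
  IsReg := fun U f => A.IsReg (π ⁻¹' U) (f ∘ π)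
  congr := fun h hf => A.congr (fun _ hx => h hx) hf
  const := fun _ c => A.const _ c
  add := fun hf hg => A.add hf hg
  mul := fun hf hg => A.mul hf hg
  mono := fun hV hVU hf => A.mono hV (fun _ hx => hVU hx) hf
  glue := fun h => A.glue fun x hx => by
    obtain ⟨V, hV, hxV, hVU, hf⟩ := h (π x) hx
    exact ⟨π ⁻¹' V, hV, hxV, fun _ hy => hVU hy, hf⟩
  isOpen_ne := fun hU hf => A.isOpen_ne hU hf
  inv := fun hU hf => A.inv hU hf

/-- The algebra of functions on `U × V` of the form `∑ aᵢ(x) bᵢ(y)` with `aᵢ` regular on `U` and `bᵢ`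
regular on `V`. -/
def boxAlgebra (A : FunSpace X) (B : FunSpace Y) (U : Set X) (V : Set Y) :
    Subalgebra ℂ (X × Y → ℂ) :=
  Algebra.adjoin ℂ ({h | ∃ a, A.IsReg U a ∧ h = fun z => a z.1} ∪
    {h | ∃ b, B.IsReg V b ∧ h = fun z => b z.2})

lemma boxAlgebra_mono (A : FunSpace X) (B : FunSpace Y) {U U' : Set X} {V V' : Set Y}
    (hU : IsOpen[A.top] U') (hV : IsOpen[B.top] V') (hUU : U' ⊆ U) (hVV : V' ⊆ V) :
    boxAlgebra A B U V ≤ boxAlgebra A B U' V' := by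
  refine Algebra.adjoin_mono (Set.union_subset_union ?_ ?_)
  · rintro _ ⟨a, ha, rfl⟩
    exact ⟨a, A.mono hU hUU ha, rfl⟩
  · rintro _ ⟨b, hb, rfl⟩
    exact ⟨b, B.mono hV hVV hb, rfl⟩

/-- Two functions in box algebras around a common point lie in one box algebra around it. -/
lemma exists_common_box (A : FunSpace X) (B : FunSpace Y) {U₁ U₂ : Set X} {V₁ V₂ : Set Y}
    (hU₁ : IsOpen[A.top] U₁) (hU₂ : IsOpen[A.top] U₂) (hV₁ : IsOpen[B.top] V₁)
    (hV₂ : IsOpen[B.top] V₂) :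
    IsOpen[A.top] (U₁ ∩ U₂) ∧ IsOpen[B.top] (V₁ ∩ V₂) ∧
    boxAlgebra A B U₁ V₁ ≤ boxAlgebra A B (U₁ ∩ U₂) (V₁ ∩ V₂) ∧
    boxAlgebra A B U₂ V₂ ≤ boxAlgebra A B (U₁ ∩ U₂) (V₁ ∩ V₂) := by
  have hU := A.top.isOpen_inter _ _ hU₁ hU₂
  have hV := B.top.isOpen_inter _ _ hV₁ hV₂
  exact ⟨hU, hV, boxAlgebra_mono A B hU hV Set.inter_subset_left Set.inter_subset_left,
    boxAlgebra_mono A B hU hV Set.inter_subset_right Set.inter_subset_right⟩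

/-- The product of two spaces with functions (for varieties, the product variety). A base of the
topology is given by the nonvanishing loci in `U × V` of functions `∑ aᵢ(x) bᵢ(y)`, where `U` and
`V` are open and the `aᵢ`, `bᵢ` are regular on them; regular functions are locally quotients of
functions of this form. -/
def prod (A : FunSpace X) (B : FunSpace Y) : FunSpace (X × Y) where
  top :=
    { IsOpen := fun W => ∀ z ∈ W, ∃ U V, IsOpen[A.top] U ∧ IsOpen[B.top] V ∧ z ∈ U ×ˢ V ∧
        ∃ q ∈ boxAlgebra A B U V, q z ≠ 0 ∧ ∀ y ∈ U ×ˢ V, q y ≠ 0 → y ∈ W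
      isOpen_univ := fun z _ => ⟨Set.univ, Set.univ, A.top.isOpen_univ, B.top.isOpen_univ,
        by simp, 1, one_mem _, by simp, fun _ _ _ => trivial⟩
      isOpen_inter := by
        intro s t hs ht z hz
        obtain ⟨U, V, hU, hV, hzUV, p, hpA, hp, hp'⟩ := hs z hz.1
        obtain ⟨U', V', hU', hV', hzUV', q, hqA, hq, hq'⟩ := ht z hz.2
        obtain ⟨h1, h2, h3, h4⟩ := exists_common_box A B hU hU' hV hV'
        refine ⟨_, _, h1, h2, ⟨⟨hzUV.1, hzUV'.1⟩, ⟨hzUV.2, hzUV'.2⟩⟩, p * q,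
          mul_mem (h3 hpA) (h4 hqA), mul_ne_zero hp hq, fun y hy hpq => ?_⟩
        exact ⟨hp' y ⟨hy.1.1, hy.2.1⟩ (left_ne_zero_of_mul hpq),
          hq' y ⟨hy.1.2, hy.2.2⟩ (right_ne_zero_of_mul hpq)⟩
      isOpen_sUnion := by
        intro S hS z ⟨t, ht, hz⟩
        obtain ⟨U, V, hU, hV, hzUV, q, hqA, hq, hq'⟩ := hS t ht z hz
        exact ⟨U, V, hU, hV, hzUV, q, hqA, hq, fun y hy hqy => ⟨t, ht, hq' y hy hqy⟩⟩ }
  IsReg := fun W f => ∀ z ∈ W, ∃ U V, IsOpen[A.top] U ∧ IsOpen[B.top] V ∧ z ∈ U ×ˢ V ∧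
    ∃ p ∈ boxAlgebra A B U V, ∃ q ∈ boxAlgebra A B U V, q z ≠ 0 ∧
      ∀ y ∈ W, y ∈ U ×ˢ V → q y ≠ 0 → f y = p y / q y
  congr := by
    intro W f g h hf z hz
    obtain ⟨U, V, hU, hV, hzUV, p, hpA, q, hqA, hq, H⟩ := hf z hz
    exact ⟨U, V, hU, hV, hzUV, p, hpA, q, hqA, hq, fun y hy hyUV hqy => (h hy) ▸ H y hy hyUV hqy⟩
  const := fun W c z _ => ⟨Set.univ, Set.univ, A.top.isOpen_univ, B.top.isOpen_univ, by simp,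
    algebraMap ℂ _ c, Subalgebra.algebraMap_mem _ c, 1, one_mem _, by simp, by simp⟩
  add := by
    intro W f g hf hg z hz
    obtain ⟨U, V, hU, hV, hzUV, p, hpA, q, hqA, hq, H⟩ := hf z hz
    obtain ⟨U', V', hU', hV', hzUV', p', hpA', q', hqA', hq', H'⟩ := hg z hz
    obtain ⟨h1, h2, h3, h4⟩ := exists_common_box A B hU hU' hV hV'
    refine ⟨_, _, h1, h2, ⟨⟨hzUV.1, hzUV'.1⟩, ⟨hzUV.2, hzUV'.2⟩⟩, p * q' + q * p',
      add_mem (mul_mem (h3 hpA) (h4 hqA')) (mul_mem (h3 hqA) (h4 hpA')), q * q',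
      mul_mem (h3 hqA) (h4 hqA'), mul_ne_zero hq hq', fun y hy hyUV hqy => ?_⟩
    have e1 := left_ne_zero_of_mul hqy
    have e2 := right_ne_zero_of_mul hqy
    simp only [Pi.add_apply, Pi.mul_apply, H y hy ⟨hyUV.1.1, hyUV.2.1⟩ e1,
      H' y hy ⟨hyUV.1.2, hyUV.2.2⟩ e2]
    rw [div_add_div _ _ e1 e2]
  mul := by
    intro W f g hf hg z hz
    obtain ⟨U, V, hU, hV, hzUV, p, hpA, q, hqA, hq, H⟩ := hf z hz
    obtain ⟨U', V', hU', hV', hzUV', p', hpA', q', hqA', hq', H'⟩ := hg z hz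
    obtain ⟨h1, h2, h3, h4⟩ := exists_common_box A B hU hU' hV hV'
    refine ⟨_, _, h1, h2, ⟨⟨hzUV.1, hzUV'.1⟩, ⟨hzUV.2, hzUV'.2⟩⟩, p * p',
      mul_mem (h3 hpA) (h4 hpA'), q * q',
      mul_mem (h3 hqA) (h4 hqA'), mul_ne_zero hq hq', fun y hy hyUV hqy => ?_⟩
    have e1 := left_ne_zero_of_mul hqy
    have e2 := right_ne_zero_of_mul hqy
    simp only [Pi.mul_apply, H y hy ⟨hyUV.1.1, hyUV.2.1⟩ e1,
      H' y hy ⟨hyUV.1.2, hyUV.2.2⟩ e2]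
    rw [div_mul_div_comm]
  mono := by
    intro W W' f _ hWW hf z hz
    obtain ⟨U, V, hU, hV, hzUV, p, hpA, q, hqA, hq, H⟩ := hf z (hWW hz)
    exact ⟨U, V, hU, hV, hzUV, p, hpA, q, hqA, hq, fun y hy => H y (hWW hy)⟩
  glue := by
    intro W f h z hz
    obtain ⟨W', hW', hzW', hWW, hf⟩ := h z hz
    obtain ⟨U, V, hU, hV, hzUV, p, hpA, q, hqA, hq, H⟩ := hf z hzW'
    obtain ⟨U', V', hU', hV', hzUV', r, hrA, hr, hr'⟩ := hW' z hzW'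
    obtain ⟨h1, h2, h3, h4⟩ := exists_common_box A B hU hU' hV hV'
    refine ⟨_, _, h1, h2, ⟨⟨hzUV.1, hzUV'.1⟩, ⟨hzUV.2, hzUV'.2⟩⟩, p * r,
      mul_mem (h3 hpA) (h4 hrA), q * r,
      mul_mem (h3 hqA) (h4 hrA), mul_ne_zero hq hr, fun y hy hyUV hqy => ?_⟩
    have e1 := left_ne_zero_of_mul hqy
    have e2 := right_ne_zero_of_mul hqy
    rw [H y (hr' y ⟨hyUV.1.2, hyUV.2.2⟩ e2) ⟨hyUV.1.1, hyUV.2.1⟩ e1]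
    simp only [Pi.mul_apply]
    rw [mul_div_mul_right _ _ e2]
  isOpen_ne := by
    intro W f hW hf z hz
    obtain ⟨U, V, hU, hV, hzUV, p, hpA, q, hqA, hq, H⟩ := hf z hz.1
    obtain ⟨U', V', hU', hV', hzUV', r, hrA, hr, hr'⟩ := hW z hz.1
    obtain ⟨h1, h2, h3, h4⟩ := exists_common_box A B hU hU' hV hV'
    have hp : p z ≠ 0 := fun h0 => hz.2 (by simp [H z hz.1 hzUV hq, h0])
    refine ⟨_, _, h1, h2, ⟨⟨hzUV.1, hzUV'.1⟩, ⟨hzUV.2, hzUV'.2⟩⟩, p * q * r,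
      mul_mem (mul_mem (h3 hpA) (h3 hqA)) (h4 hrA), mul_ne_zero (mul_ne_zero hp hq) hr,
      fun y hyUV hy => ?_⟩
    have e1 := left_ne_zero_of_mul hy
    have hyW := hr' y ⟨hyUV.1.2, hyUV.2.2⟩ (right_ne_zero_of_mul hy)
    refine ⟨hyW, ?_⟩
    rw [H y hyW ⟨hyUV.1.1, hyUV.2.1⟩ (right_ne_zero_of_mul e1)]
    exact div_ne_zero (left_ne_zero_of_mul e1) (right_ne_zero_of_mul e1)
  inv := by
    intro W f _ hf z hz
    obtain ⟨U, V, hU, hV, hzUV, p, hpA, q, hqA, hq, H⟩ := hf z hz.1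
    have hp : p z ≠ 0 := fun h0 => hz.2 (by simp [H z hz.1 hzUV hq, h0])
    refine ⟨U, V, hU, hV, hzUV, q * q, mul_mem hqA hqA, p * q, mul_mem hpA hqA,
      mul_ne_zero hp hq, fun y hy hyUV hqy => ?_⟩
    have e2 := right_ne_zero_of_mul hqy
    simp only [Pi.inv_apply, Pi.mul_apply, H y hy.1 hyUV e2]
    rw [inv_div, mul_div_mul_right _ _ e2]

end FunSpace

/-! ### Bruhat order on the symmetric group -/

/-- The length of a permutation: its number of inversions. -/
def permLength {k : ℕ} (w : Equiv.Perm (Fin k)) : ℕ :=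
  (Finset.univ.filter fun p : Fin k × Fin k => p.1 < p.2 ∧ w p.2 < w p.1).card

/-- The (strong) Bruhat order: the reflexive and transitive closure of the relations `u < u t` with
`t` a transposition and `ℓ(u) < ℓ(u t)`. -/
def BruhatLE {k : ℕ} (u v : Equiv.Perm (Fin k)) : Prop :=
  Relation.ReflTransGen
    (fun x y : Equiv.Perm (Fin k) => ∃ i j : Fin k, i ≠ j ∧ y = x * Equiv.swap i j ∧
      permLength x < permLength y) u v

/-- The longest element `i ↦ k + 1 - i` (in the 1-based numbering) of `S_k`. -/
def longest (k : ℕ) : Equiv.Perm (Fin k) := Fin.revPerm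

/-! ### Complete flags -/

/-- A complete flag `0 = F₀ ⊆ F₁ ⊆ ⋯ ⊆ F_k = ℂ^k` with `dim F_i = i`. -/
@[ext]
structure CFlag (k : ℕ) where
  /-- the subspace `F_i` -/
  sub : Fin (k + 1) → Submodule ℂ (Fin k → ℂ)
  mono : Monotone sub
  finrank_sub : ∀ i, Module.finrank ℂ (sub i) = (i : ℕ)

namespace CFlag

variable {k : ℕ}

/-- The flag `0 ⊆ ⟨b₁⟩ ⊆ ⟨b₁, b₂⟩ ⊆ ⋯` spanned by linearly independent vectors `b₁, …, b_k`. -/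
def ofVectors (b : Fin k → Fin k → ℂ) (hb : LinearIndependent ℂ b) : CFlag k where
  sub i := Submodule.span ℂ (b '' {j | (j : ℕ) < i})
  mono := fun _ _ h =>
    Submodule.span_mono (Set.image_mono fun j (hj : (j : ℕ) < _) => lt_of_lt_of_le hj (Fin.le_def.1 h))
  finrank_sub := by
    intro i
    have h1 : b '' {j | (j : ℕ) < i} = Set.range fun j : Fin i => b ⟨j, by omega⟩ := by
      ext x
      constructor
      · rintro ⟨j, hj, rfl⟩
        exact ⟨⟨j, hj⟩, rfl⟩
      · rintro ⟨j, rfl⟩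
        exact ⟨_, j.2, rfl⟩
    rw [h1, finrank_span_eq_card, Fintype.card_fin]
    exact hb.comp _ fun x y h => by simpa [Fin.ext_iff] using h

/-- The flag `F(M)` spanned by the columns of an invertible matrix `M`. -/
def ofMatrix (M : GL (Fin k) ℂ) : CFlag k :=
  ofVectors (fun j i => (M : Matrix (Fin k) (Fin k) ℂ) i j)
    (Matrix.linearIndependent_cols_of_isUnit M.isUnit)

/-- The coordinate flag `F(w)` spanned by `e_{w(1)}, …, e_{w(k)}`. -/
def coord (w : Equiv.Perm (Fin k)) : CFlag k :=
  ofVectors (fun j => Pi.single (w j) 1)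
    ((Pi.linearIndependent_single_one (Fin k) ℂ).comp w w.injective)

/-- The standard flag `F(e)`. -/
def std (k : ℕ) : CFlag k := coord 1

/-- The antistandard flag `F(w₀)`. -/
def ant (k : ℕ) : CFlag k := coord (longest k)

/-- The action of `GL(k)` on flags, `(g F)_i = g(F_i)`. -/
def act (g : GL (Fin k) ℂ) (F : CFlag k) : CFlag k where
  sub i := (F.sub i).map (Matrix.mulVecLin (g : Matrix (Fin k) (Fin k) ℂ))
  mono := fun _ _ h => Submodule.map_mono (F.mono h)
  finrank_sub := by
    intro i
    rw [← F.finrank_sub i]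
    exact (Submodule.equivMapOfInjective _ (Matrix.mulVec_injective_of_isUnit g.isUnit)
      (F.sub i)).finrank_eq.symm

/-- `F` and `F'` are in relative position `w`: some `g ∈ GL(k)` takes `F` to the standard flag and
`F'` to `F(w)`. -/
def RelPos (w : Equiv.Perm (Fin k)) (F F' : CFlag k) : Prop :=
  ∃ g : GL (Fin k) ℂ, act g F = std k ∧ act g F' = coord w

/-- Transversality of flags: relative position `w₀`. -/
def Transverse (F F' : CFlag k) : Prop := RelPos (longest k) F F'

/-- `GL(k)` as an open subvariety of the affine space of `k × k` matrices. -/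
def glSpace (k : ℕ) : FunSpace (GL (Fin k) ℂ) :=
  FunSpace.induced (fun M p => (M : Matrix (Fin k) (Fin k) ℂ) p.1 p.2)
    (FunSpace.affine (Fin k × Fin k))

/-- The flag variety `GL(k)/B(k)`, as the quotient of `GL(k)` by the map `M ↦ F(M)`. -/
def flagVariety (k : ℕ) : FunSpace (CFlag k) :=
  FunSpace.quotient ofMatrix (glSpace k)

/-- A set of flags as a subspace of the flag variety. -/
def subvariety (S : Set (CFlag k)) : FunSpace S :=
  FunSpace.induced Subtype.val (flagVariety k)

/-- The open Richardson variety `R(u, w)`: flags `F` such that the position of the standard flag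
and `F` is `w`, and the position of `F` and the antistandard flag is `u⁻¹ w₀`. -/
def richardson (u w : Equiv.Perm (Fin k)) : Set (CFlag k) :=
  {F | RelPos w (std k) F ∧ RelPos (u⁻¹ * longest k) F (ant k)}

/-- The flags in `R(u, w)` that are transverse to `F(v w₀)`. -/
def splicingSet (u v w : Equiv.Perm (Fin k)) : Set (CFlag k) :=
  {F | F ∈ richardson u w ∧ Transverse F (coord (v * longest k))}

end CFlag

end SplicedFlags

end

noncomputable section

open scoped Topology

namespace SplicedFlags

/-! ### Morphisms and regular functions on spaces with functions. -/

namespace FunSpace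

variable {X Y Z : Type}

/-! The flags transverse to `F(v w₀)` form the open cell at `F(v)`: each is `g F(v)` for exactly one
`g` in `v U₋ v⁻¹` (`transverse_iff`, `cellRep`). Such a `g` is triangular for a reordering of the
basis, so all its leading principal submatrices are triangular too and its leading minors do not
vanish (`leadProd_ne_zero_of_mem_tri`). The same holds for `g⁻¹`. Hence `g = L R = R' L'` with `L`,
`L'` lower unitriangular and `R`, `R'` upper triangular, and all four factors stay in `v U₋ v⁻¹`
(`luLower_mem_tri`).

The flag `R F(v) = L⁻¹ F` lies in the upper Borel orbit of `F(v)` and in the lower Borel orbit of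
`F`, so it belongs to `R(u, v)`. Likewise `L' F(v) = R'⁻¹ F` belongs to `R(v, w)`. This pair
determines `F`: since `R L'⁻¹ = L⁻¹ R'`, factoring `R L'⁻¹` returns `R'`, and `g = R' L'`. Every
factorization is given by rational formulas whose denominators do not vanish, so the bijection
`spliceEquiv` is an isomorphism.

For principality, `R(u, w)` lies in the open cell at `F(w)`, where flags lift regularly to matrices;
membership in the cell at `F(v)` is then the nonvanishing of a product of minors of the lift.

For the converse, the two components give points of `R(u, v)` and `R(v, w)`. A point of a Richardson
variety forces a Bruhat relation: comparing dimensions inside `F_j` gives inequalities of corner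
counts (`cornerCount_le_of_mem`), and the tableau criterion `bruhatLE_of_cornerCount_le` concludes.
-/

lemma IsMorphism.comp {A : FunSpace X} {B : FunSpace Y} {C : FunSpace Z} {ψ : Y → Z} {φ : X → Y}
    (hψ : B.IsMorphism C ψ) (hφ : A.IsMorphism B φ) : A.IsMorphism C (ψ ∘ φ) := fun V hV =>
  ⟨(hφ _ (hψ V hV).1).1, fun g hg => (hφ _ (hψ V hV).1).2 _ ((hψ V hV).2 g hg)⟩

lemma isMorphism_induced_val (i : X → Y) (B : FunSpace Y) : (induced i B).IsMorphism B i :=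
  fun V hV => ⟨⟨V, hV, rfl⟩, fun g hg _ hx => ⟨V, hV, hx, g, hg, fun _ _ _ => rfl⟩⟩

lemma isMorphism_quotient (π : X → Y) (A : FunSpace X) : A.IsMorphism (quotient π A) π :=
  fun _ hV => ⟨hV, fun _ hg => hg⟩

lemma IsMorphism.to_induced {A : FunSpace X} {B : FunSpace Z} {i : Y → Z} {φ : X → Y}
    (h : A.IsMorphism B (i ∘ φ)) : A.IsMorphism (induced i B) φ := by
  rintro _ ⟨W, hW, rfl⟩
  refine ⟨(h W hW).1, fun g hg => A.glue fun x hx => ?_⟩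
  obtain ⟨V, hV, hxV, e, he, H⟩ := hg (φ x) hx
  have hVW : IsOpen[A.top] ((i ∘ φ) ⁻¹' W ∩ (i ∘ φ) ⁻¹' V) :=
    A.top.isOpen_inter _ _ (h W hW).1 (h V hV).1
  exact ⟨_, hVW, ⟨hx, hxV⟩, Set.inter_subset_left,
    A.congr (fun y hy => (H (φ y) hy.1 hy.2).symm)
      (A.mono hVW Set.inter_subset_right ((h V hV).2 e he))⟩

lemma isOpen_of_local (A : FunSpace X) {S : Set X}
    (h : ∀ x ∈ S, ∃ V, IsOpen[A.top] V ∧ x ∈ V ∧ V ⊆ S) : IsOpen[A.top] S := by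
  let _ := A.top
  refine isOpen_iff_forall_mem_open.2 fun x hx => ?_
  obtain ⟨V, hV, hxV, hVS⟩ := h x hx
  exact ⟨V, hVS, hV, hxV⟩

section Regular

variable {A : FunSpace X} {U : Set X}

lemma IsReg.sum {ι : Type*} (s : Finset ι) {f : ι → X → ℂ} (h : ∀ i ∈ s, A.IsReg U (f i)) :
    A.IsReg U (fun x => ∑ i ∈ s, f i x) := by
  classical
  induction s using Finset.induction_on with
  | empty => simpa using A.const U 0
  | insert a s ha ih =>
    simp only [Finset.sum_insert ha]
    exact A.add (h a (by simp)) (ih fun i hi => h i (by simp [hi]))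

lemma IsReg.prod {ι : Type*} (s : Finset ι) {f : ι → X → ℂ} (h : ∀ i ∈ s, A.IsReg U (f i)) :
    A.IsReg U (fun x => ∏ i ∈ s, f i x) := by
  classical
  induction s using Finset.induction_on with
  | empty => simpa using A.const U 1
  | insert a s ha ih =>
    simp only [Finset.prod_insert ha]
    exact A.mul (h a (by simp)) (ih fun i hi => h i (by simp [hi]))

lemma IsReg.inv_of_ne_zero {f : X → ℂ} (hU : IsOpen[A.top] U) (hf : A.IsReg U f)
    (h0 : ∀ x ∈ U, f x ≠ 0) : A.IsReg U (fun x => (f x)⁻¹) := by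
  have := A.inv hU hf
  rwa [show {x | x ∈ U ∧ f x ≠ 0} = U from Set.ext fun x => ⟨fun h => h.1, fun h => ⟨h, h0 x h⟩⟩]
    at this

/-- The entries of a matrix-valued function are regular on `U`. -/
def IsRegMatrix (A : FunSpace X) (U : Set X) {m n : Type*} (M : X → Matrix m n ℂ) : Prop :=
  ∀ i j, A.IsReg U (fun x => M x i j)

variable {m n p : Type*}

lemma IsRegMatrix.mul [Fintype n] {M : X → Matrix m n ℂ} {N : X → Matrix n p ℂ}
    (hM : A.IsRegMatrix U M) (hN : A.IsRegMatrix U N) : A.IsRegMatrix U (fun x => M x * N x) :=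
  fun i j => IsReg.sum _ fun l _ => A.mul (hM i l) (hN l j)

lemma isRegMatrix_const (N : Matrix m n ℂ) : A.IsRegMatrix U (fun _ => N) :=
  fun i j => A.const _ (N i j)

lemma IsRegMatrix.det [Fintype n] [DecidableEq n] {M : X → Matrix n n ℂ}
    (hM : A.IsRegMatrix U M) : A.IsReg U (fun x => (M x).det) := by
  simp only [Matrix.det_apply']
  exact IsReg.sum _ fun σ _ => A.mul (A.const _ _) (IsReg.prod _ fun i _ => hM _ _)

lemma IsRegMatrix.inv [Fintype n] [DecidableEq n] {M : X → Matrix n n ℂ} (hU : IsOpen[A.top] U)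
    (hM : A.IsRegMatrix U M) (h0 : ∀ x ∈ U, (M x).det ≠ 0) :
    A.IsRegMatrix U (fun x => (M x)⁻¹) := by
  intro i j
  simp only [Matrix.inv_def, Ring.inverse_eq_inv', Matrix.smul_apply, smul_eq_mul,
    Matrix.adjugate_apply]
  refine A.mul (hM.det.inv_of_ne_zero hU h0) (IsRegMatrix.det fun a b => ?_)
  -- The adjugate entry is the determinant of the matrix with row `j` replaced by a constant basis
  -- vector.
  by_cases h : a = j
  · subst h; simpa using A.const U _
  · simpa [h] using hM a b

lemma IsRegMatrix.comp {B : FunSpace Y} {M : Y → Matrix m n ℂ} {φ : X → Y}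
    (hM : B.IsRegMatrix Set.univ M) (hφ : A.IsMorphism B φ) :
    A.IsRegMatrix Set.univ (fun x => M (φ x)) := fun i j =>
  (hφ Set.univ B.top.isOpen_univ).2 _ (hM i j)

end Regular

lemma isReg_coordinate {σ : Type} (U : Set (σ → ℂ)) (s : σ) :
    (affine σ).IsReg U (fun x => x s) :=
  fun _ _ => ⟨MvPolynomial.X s, 1, by simp, by simp⟩

/-- Polynomials in regular functions are regular, and so are their quotients where the denominator
does not vanish; coordinates therefore suffice. -/
lemma isMorphism_affine {A : FunSpace X} {σ : Type} {φ : X → σ → ℂ}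
    (h : ∀ s, A.IsReg Set.univ (fun x => φ x s)) : A.IsMorphism (affine σ) φ := by
  have huniv : IsOpen[A.top] (Set.univ : Set X) := A.top.isOpen_univ
  have hp : ∀ p : MvPolynomial σ ℂ, A.IsReg Set.univ (fun x => MvPolynomial.eval (φ x) p) := by
    intro p
    induction p using MvPolynomial.induction_on with
    | C a => simpa using A.const Set.univ a
    | add p q hp hq => simp only [map_add]; exact A.add hp hq
    | mul_X p s hp =>
      simp only [map_mul, MvPolynomial.eval_X]
      exact A.mul hp (h s)
  have hopen : ∀ q : MvPolynomial σ ℂ, IsOpen[A.top] {x | MvPolynomial.eval (φ x) q ≠ 0} := by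
    intro q
    simpa using A.isOpen_ne huniv (hp q)
  intro V hV
  have hV' : IsOpen[A.top] (φ ⁻¹' V) := A.isOpen_of_local fun x hx => by
    obtain ⟨q, hq, hqV⟩ := hV _ hx
    exact ⟨_, hopen q, hq, fun y hy => hqV _ hy⟩
  refine ⟨hV', fun g hg => A.glue fun x hx => ?_⟩
  obtain ⟨p, q, hq, H⟩ := hg _ hx
  have hW : IsOpen[A.top] (φ ⁻¹' V ∩ {x | MvPolynomial.eval (φ x) q ≠ 0}) :=
    A.top.isOpen_inter _ _ hV' (hopen q)
  refine ⟨_, hW, ⟨hx, hq⟩, Set.inter_subset_left, ?_⟩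
  refine A.congr (fun y hy => (H (φ y) hy.1 hy.2).symm) ?_
  simp only [div_eq_mul_inv]
  exact A.mul (A.mono hW (Set.subset_univ _) (hp p))
    ((A.mono hW (Set.subset_univ _) (hp q) : A.IsReg _ _).inv_of_ne_zero hW fun y hy => hy.2)

lemma isMorphism_fst (A : FunSpace X) (B : FunSpace Y) : (A.prod B).IsMorphism A Prod.fst := by
  intro V hV
  refine ⟨fun z hz => ⟨V, Set.univ, hV, B.top.isOpen_univ, ⟨hz, trivial⟩, 1, one_mem _, by simp,
    fun y hy _ => hy.1⟩, fun g hg z hz => ?_⟩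
  exact ⟨V, Set.univ, hV, B.top.isOpen_univ, ⟨hz, trivial⟩, fun z => g z.1,
    Algebra.subset_adjoin (Or.inl ⟨g, hg, rfl⟩), 1, one_mem _, by simp, by simp⟩

lemma isMorphism_snd (A : FunSpace X) (B : FunSpace Y) : (A.prod B).IsMorphism B Prod.snd := by
  intro V hV
  refine ⟨fun z hz => ⟨Set.univ, V, A.top.isOpen_univ, hV, ⟨trivial, hz⟩, 1, one_mem _, by simp,
    fun y hy _ => hy.2⟩, fun g hg z hz => ?_⟩
  exact ⟨Set.univ, V, A.top.isOpen_univ, hV, ⟨trivial, hz⟩, fun z => g z.2,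
    Algebra.subset_adjoin (Or.inr ⟨g, hg, rfl⟩), 1, one_mem _, by simp, by simp⟩

/-- Universal property of the product: elements of a box algebra pull back to regular functions, by
induction on their generation. -/
lemma IsMorphism.prodMk {A : FunSpace X} {B : FunSpace Y} {C : FunSpace Z} {φ : X → Y} {ψ : X → Z}
    (hφ : A.IsMorphism B φ) (hψ : A.IsMorphism C ψ) :
    A.IsMorphism (B.prod C) (fun x => (φ x, ψ x)) := by
  have hO : ∀ {U V}, IsOpen[B.top] U → IsOpen[C.top] V → IsOpen[A.top] (φ ⁻¹' U ∩ ψ ⁻¹' V) :=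
    fun hU hV => A.top.isOpen_inter _ _ (hφ _ hU).1 (hψ _ hV).1
  have hp : ∀ {U V}, IsOpen[B.top] U → IsOpen[C.top] V → ∀ p ∈ boxAlgebra B C U V,
      A.IsReg (φ ⁻¹' U ∩ ψ ⁻¹' V) (fun x => p (φ x, ψ x)) := by
    intro U V hU hV p hp
    induction hp using Algebra.adjoin_induction with
    | mem p hp =>
      obtain ⟨a, ha, rfl⟩ | ⟨a, ha, rfl⟩ := hp
      · exact A.mono (hO hU hV) Set.inter_subset_left ((hφ _ hU).2 a ha)
      · exact A.mono (hO hU hV) Set.inter_subset_right ((hψ _ hV).2 a ha)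
    | algebraMap r => exact A.const _ r
    | add p q _ _ hp hq => exact A.add hp hq
    | mul p q _ _ hp hq => exact A.mul hp hq
  intro W hW
  have hW' : IsOpen[A.top] ((fun x => (φ x, ψ x)) ⁻¹' W) := A.isOpen_of_local fun x hx => by
    obtain ⟨U, V, hU, hV, hz, q, hqA, hq, hqW⟩ := hW _ hx
    exact ⟨_, A.isOpen_ne (hO hU hV) (hp hU hV q hqA), ⟨hz, hq⟩, fun y hy => hqW _ hy.1 hy.2⟩
  refine ⟨hW', fun g hg => A.glue fun x hx => ?_⟩
  obtain ⟨U, V, hU, hV, hz, p, hpA, q, hqA, hq, H⟩ := hg _ hx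
  have hN := A.isOpen_ne (hO hU hV) (hp hU hV q hqA)
  have hN' : IsOpen[A.top] ((fun x => (φ x, ψ x)) ⁻¹' W ∩
    {x | x ∈ φ ⁻¹' U ∩ ψ ⁻¹' V ∧ q (φ x, ψ x) ≠ 0}) := A.top.isOpen_inter _ _ hW' hN
  refine ⟨_, hN', ⟨hx, hz, hq⟩, Set.inter_subset_left, ?_⟩
  refine A.congr (fun y hy => (H _ hy.1 hy.2.1 hy.2.2).symm) ?_
  simp only [div_eq_mul_inv]
  have hs : (fun x => (φ x, ψ x)) ⁻¹' W ∩ {x | x ∈ φ ⁻¹' U ∩ ψ ⁻¹' V ∧ q (φ x, ψ x) ≠ 0} ⊆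
    φ ⁻¹' U ∩ ψ ⁻¹' V := fun y hy => hy.2.1
  exact A.mul (A.mono hN' hs (hp hU hV p hpA))
    ((A.mono hN' hs (hp hU hV q hqA) : A.IsReg _ _).inv_of_ne_zero hN' fun y hy => hy.2.2)

end FunSpace

end SplicedFlags

namespace SplicedFlags

/-! ### Triangular matrices and the LU factorization -/

section Triangular

variable {k : ℕ}

lemma det_eq_prod_diag_of_blockTriangular {m α R : Type*} [Fintype m] [DecidableEq m]
    [LinearOrder α] [CommRing R] {M : Matrix m m R} {b : m → α} (hb : Function.Injective b)
    (h : M.BlockTriangular b) : M.det = ∏ i, M i i := by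
  let _ : LinearOrder m := LinearOrder.lift' b hb
  have h' : M.BlockTriangular id := fun i j hij => h hij
  convert Matrix.det_of_isUpperTriangular h'

/-- The invertible matrices `g` that are upper triangular in the order `σ` of the index set:
`g i j = 0` unless `σ i ≤ σ j`. -/
def tri (σ : Equiv.Perm (Fin k)) : Subgroup (GL (Fin k) ℂ) where
  carrier := {g | (g : Matrix (Fin k) (Fin k) ℂ).BlockTriangular σ}
  mul_mem' := fun ha hb => by
    simpa only [Set.mem_ofPred_eq, Units.val_mul] using Matrix.BlockTriangular.mul ha hb
  one_mem' := Matrix.blockTriangular_one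
  inv_mem' := fun {g} hg => by
    have := g.isUnit.invertible
    simpa only [Set.mem_ofPred_eq, Matrix.coe_units_inv] using
      Matrix.blockTriangular_inv_of_blockTriangular hg

lemma mem_tri {σ : Equiv.Perm (Fin k)} {g : GL (Fin k) ℂ} :
    g ∈ tri σ ↔ ∀ i j, σ j < σ i → (g : Matrix (Fin k) (Fin k) ℂ) i j = 0 :=
  ⟨fun h _ _ hij => h hij, fun h i j hij => h i j hij⟩

/-- An index other than `i` lies strictly before or after `i` in the order `σ`, so one of the two
factors vanishes. -/
lemma mul_apply_self_of_mem_tri {σ : Equiv.Perm (Fin k)} {g h : GL (Fin k) ℂ} (hg : g ∈ tri σ)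
    (hh : h ∈ tri σ) (i : Fin k) : (g * h : GL (Fin k) ℂ) i i = g i i * h i i := by
  rw [Units.val_mul, Matrix.mul_apply]
  refine Finset.sum_eq_single i (fun l _ hl => ?_) (by simp)
  rcases lt_or_gt_of_ne (fun e => hl (σ.injective e) : σ l ≠ σ i) with h1 | h1
  · rw [mem_tri.1 hg _ _ h1, zero_mul]
  · rw [mem_tri.1 hh _ _ h1, mul_zero]

/-- The unipotent elements of `tri σ`. -/
def uniTri (σ : Equiv.Perm (Fin k)) : Subgroup (GL (Fin k) ℂ) where
  carrier := {g | g ∈ tri σ ∧ ∀ i, g i i = 1}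
  mul_mem' := fun ha hb => ⟨mul_mem ha.1 hb.1, fun i => by
    rw [mul_apply_self_of_mem_tri ha.1 hb.1, ha.2, hb.2, one_mul]⟩
  one_mem' := ⟨one_mem _, fun i => by simp⟩
  inv_mem' := fun {g} hg => ⟨inv_mem hg.1, fun i => by
    have := mul_apply_self_of_mem_tri hg.1 (inv_mem hg.1) i
    rw [mul_inv_cancel, hg.2, one_mul] at this
    simpa using this.symm⟩

lemma mem_uniTri {σ : Equiv.Perm (Fin k)} {g : GL (Fin k) ℂ} :
    g ∈ uniTri σ ↔ g ∈ tri σ ∧ ∀ i, g i i = 1 := Iff.rfl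

/-- The diagonal entries of an element of `tri σ` that is unipotent in another order are `1`. -/
lemma mem_uniTri_of_mem_tri {σ τ : Equiv.Perm (Fin k)} {g : GL (Fin k) ℂ} (h : g ∈ tri σ)
    (h' : g ∈ uniTri τ) : g ∈ uniTri σ := ⟨h, h'.2⟩

lemma longest_mul_lt {σ : Equiv.Perm (Fin k)} {i j : Fin k} :
    (longest k * σ) i < (longest k * σ) j ↔ σ j < σ i := by
  simp [longest]

/-- Opposite orders kill all off-diagonal entries. This is the source of uniqueness in the LU
factorization. -/
lemma eq_one_of_mem_tri {σ : Equiv.Perm (Fin k)} {g : GL (Fin k) ℂ} (h : g ∈ tri σ)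
    (h' : g ∈ uniTri (longest k * σ)) : g = 1 := by
  refine Units.ext (Matrix.ext fun i j => ?_)
  rcases lt_trichotomy (σ i) (σ j) with h1 | h1 | h1
  · rw [mem_tri.1 h'.1 i j (longest_mul_lt.2 h1)]
    simp [show i ≠ j from fun e => h1.ne (congrArg σ e)]
  · obtain rfl := σ.injective h1
    simpa using h'.2 i
  · rw [mem_tri.1 h i j h1]
    simp [show i ≠ j from fun e => h1.ne' (congrArg σ e)]

lemma apply_self_ne_zero_of_mem_tri {σ : Equiv.Perm (Fin k)} {g : GL (Fin k) ℂ} (h : g ∈ tri σ)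
    (i : Fin k) : g i i ≠ 0 := by
  intro h0
  have := mul_apply_self_of_mem_tri h (inv_mem h) i
  rw [mul_inv_cancel, h0, zero_mul] at this
  simp at this

/-- The leading principal submatrix with rows and columns up to `j`. -/
def lead (M : Matrix (Fin k) (Fin k) ℂ) (j : Fin k) : Matrix {l // l ≤ j} {l // l ≤ j} ℂ :=
  M.submatrix Subtype.val Subtype.val

/-- The product of the leading principal minors. -/
def leadProd (M : Matrix (Fin k) (Fin k) ℂ) : ℂ := ∏ j, (lead M j).det

lemma lead_det_ne_zero {M : Matrix (Fin k) (Fin k) ℂ} (h : leadProd M ≠ 0) (j : Fin k) :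
    (lead M j).det ≠ 0 := Finset.prod_ne_zero_iff.1 h j (Finset.mem_univ _)

/-- Restricting rows and columns to the same subset preserves triangularity for any order, so each
leading minor is a product of nonzero diagonal entries. -/
lemma leadProd_ne_zero_of_mem_tri {σ : Equiv.Perm (Fin k)} {g : GL (Fin k) ℂ} (h : g ∈ tri σ) :
    leadProd (g : Matrix (Fin k) (Fin k) ℂ) ≠ 0 := by
  refine Finset.prod_ne_zero_iff.2 fun j _ => ?_
  rw [lead, det_eq_prod_diag_of_blockTriangular (σ.injective.comp Subtype.val_injective)
    (Matrix.BlockTriangular.submatrix h)]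
  exact Finset.prod_ne_zero_iff.2 fun i _ => apply_self_ne_zero_of_mem_tri h _

lemma sum_subtype_le {j : Fin k} {f : Fin k → ℂ} (h : ∀ l, j < l → f l = 0) :
    ∑ l : {l // l ≤ j}, f l = ∑ l, f l := by
  rw [← Finset.sum_subtype (Finset.univ.filter (· ≤ j)) (by simp) f]
  refine Finset.sum_filter_of_ne fun l _ hl => ?_
  by_contra hcon
  exact hl (h l (not_le.1 hcon))

lemma lead_mul (M : Matrix (Fin k) (Fin k) ℂ) {y : GL (Fin k) ℂ} (hy : y ∈ tri 1) (j : Fin k) :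
    lead (M * (y : Matrix (Fin k) (Fin k) ℂ)) j =
      lead M j * lead (y : Matrix (Fin k) (Fin k) ℂ) j := by
  ext a c
  simp only [lead, Matrix.submatrix_apply, Matrix.mul_apply]
  symm
  exact sum_subtype_le (f := fun l => M a l * (y : Matrix (Fin k) (Fin k) ℂ) l c) fun l hl => by
    rw [mem_tri.1 hy l c (by simpa using lt_of_le_of_lt c.2 hl), mul_zero]

lemma leadProd_mul (M : Matrix (Fin k) (Fin k) ℂ) {y : GL (Fin k) ℂ} (hy : y ∈ tri 1) :
    leadProd (M * (y : Matrix (Fin k) (Fin k) ℂ)) = leadProd M * leadProd (y : Matrix (Fin k) (Fin k) ℂ) := by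
  simp only [leadProd, lead_mul M hy, Matrix.det_mul, Finset.prod_mul_distrib]

/-- The upper triangular matrix `y` such that `M * y` is the lower unitriangular factor of `M`. -/
def luUpper (M : Matrix (Fin k) (Fin k) ℂ) : Matrix (Fin k) (Fin k) ℂ := fun l j =>
  if h : l ≤ j then (lead M j)⁻¹ ⟨l, h⟩ ⟨j, le_rfl⟩ else 0

/-- Column `j` of `luUpper M` is the last column of the inverse of `lead M j`, padded by zeros. -/
lemma mul_luUpper_apply {M : Matrix (Fin k) (Fin k) ℂ} (h : leadProd M ≠ 0) {i j : Fin k}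
    (hij : i ≤ j) : (M * luUpper M) i j = (1 : Matrix (Fin k) (Fin k) ℂ) i j := by
  have h1 := congrFun₂ (Matrix.mul_nonsing_inv (lead M j) (lead_det_ne_zero h j).isUnit)
    ⟨i, hij⟩ ⟨j, le_rfl⟩
  rw [Matrix.mul_apply, ← sum_subtype_le (j := j)]
  · rw [Matrix.mul_apply] at h1
    refine Eq.trans (Finset.sum_congr rfl fun l _ => ?_) (h1.trans ?_)
    · rw [luUpper, dif_pos l.2]; rfl
    · simp [Matrix.one_apply]
  · intro l hl
    rw [luUpper, dif_neg hl.not_ge, mul_zero]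

lemma luUpper_blockTriangular {σ : Equiv.Perm (Fin k)} {g : GL (Fin k) ℂ} (h : g ∈ tri σ) :
    (luUpper (g : Matrix (Fin k) (Fin k) ℂ)).BlockTriangular σ := by
  intro l j hlj
  rw [luUpper]
  split_ifs with hle
  · have := (Matrix.isUnit_iff_isUnit_det _).2
      (lead_det_ne_zero (leadProd_ne_zero_of_mem_tri h) j).isUnit |>.invertible
    have h1 : (lead (g : Matrix (Fin k) (Fin k) ℂ) j).BlockTriangular (σ ∘ Subtype.val) :=
      Matrix.BlockTriangular.submatrix h
    exact Matrix.blockTriangular_inv_of_blockTriangular h1 hlj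
  · rfl

lemma exists_lu {M : GL (Fin k) ℂ} (h : leadProd (M : Matrix (Fin k) (Fin k) ℂ) ≠ 0) :
    ∃ x : GL (Fin k) ℂ, x ∈ uniTri (longest k) ∧ x⁻¹ * M ∈ tri 1 ∧
      (x : Matrix (Fin k) (Fin k) ℂ) = M * luUpper (M : Matrix (Fin k) (Fin k) ℂ) := by
  set L := (M : Matrix (Fin k) (Fin k) ℂ) * luUpper (M : Matrix (Fin k) (Fin k) ℂ) with hL
  have htri : L.BlockTriangular (longest k) := by
    intro i j hij
    have hij' : i < j := by simpa [longest] using hij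
    rw [hL, mul_luUpper_apply h hij'.le, Matrix.one_apply_ne hij'.ne]
  have hdiag : ∀ i, L i i = 1 := fun i => by
    rw [hL, mul_luUpper_apply h le_rfl, Matrix.one_apply_eq]
  have hdet : L.det = 1 := by
    rw [det_eq_prod_diag_of_blockTriangular (longest k).injective htri]
    simp [hdiag]
  let x : GL (Fin k) ℂ := Matrix.GeneralLinearGroup.mkOfDetNeZero L (by simp [hdet])
  have hx : (x : Matrix (Fin k) (Fin k) ℂ) = L := rfl
  refine ⟨x, ⟨htri, hdiag⟩, ?_, hx⟩
  have hy : M⁻¹ * x ∈ tri 1 := by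
    rw [mem_tri]
    intro l j hlj
    rw [Units.val_mul, hx, hL, ← Matrix.mul_assoc, Units.inv_mul, Matrix.one_mul, luUpper, dif_neg]
    simpa using hlj
  simpa using inv_mem hy

open Classical in
/-- The lower unitriangular factor of an invertible matrix with nonzero leading principal minors
(and `1` for other matrices). -/
def luLower (M : GL (Fin k) ℂ) : GL (Fin k) ℂ :=
  if h : leadProd (M : Matrix (Fin k) (Fin k) ℂ) ≠ 0 then (exists_lu h).choose else 1

section

variable {M : GL (Fin k) ℂ}

lemma luLower_mem (M : GL (Fin k) ℂ) : luLower M ∈ uniTri (longest k) := by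
  unfold luLower
  split_ifs with h
  · exact (exists_lu h).choose_spec.1
  · exact one_mem _

lemma luLower_inv_mul_mem (h : leadProd (M : Matrix (Fin k) (Fin k) ℂ) ≠ 0) :
    (luLower M)⁻¹ * M ∈ tri 1 := by
  rw [luLower, dif_pos h]
  exact (exists_lu h).choose_spec.2.1

lemma coe_luLower (h : leadProd (M : Matrix (Fin k) (Fin k) ℂ) ≠ 0) :
    (luLower M : Matrix (Fin k) (Fin k) ℂ) = M * luUpper (M : Matrix (Fin k) (Fin k) ℂ) := by
  rw [luLower, dif_pos h]
  exact (exists_lu h).choose_spec.2.2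

/-- Inverting leading blocks preserves the pattern of zeros imposed by `σ`, so the explicit formula
shows that the factorization does not leave `tri σ`. -/
lemma luLower_mem_tri {σ : Equiv.Perm (Fin k)} (h : M ∈ tri σ) : luLower M ∈ tri σ := by
  change (luLower M : Matrix (Fin k) (Fin k) ℂ).BlockTriangular σ
  rw [coe_luLower (leadProd_ne_zero_of_mem_tri h)]
  exact Matrix.BlockTriangular.mul h (luUpper_blockTriangular h)

lemma leadProd_lower_mul_upper {x y : GL (Fin k) ℂ} (hx : x ∈ tri (longest k)) (hy : y ∈ tri 1) :
    leadProd ((x * y : GL (Fin k) ℂ) : Matrix (Fin k) (Fin k) ℂ) ≠ 0 := by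
  rw [Units.val_mul, leadProd_mul _ hy]
  exact mul_ne_zero (leadProd_ne_zero_of_mem_tri hx) (leadProd_ne_zero_of_mem_tri hy)

/-- The quotient of two candidate lower factors is both lower unitriangular and upper triangular. -/
lemma luLower_mul {x y : GL (Fin k) ℂ} (hx : x ∈ uniTri (longest k)) (hy : y ∈ tri 1) :
    luLower (x * y) = x := by
  have h1 := luLower_inv_mul_mem (leadProd_lower_mul_upper hx.1 hy)
  have h2 : (luLower (x * y))⁻¹ * x = 1 := by
    refine eq_one_of_mem_tri (σ := 1) ?_ ?_
    · simpa [mul_assoc] using mul_mem h1 (inv_mem hy)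
    · simpa using mul_mem (inv_mem (luLower_mem (x * y))) hx
  exact (inv_mul_eq_one.1 h2)

/-- The upper triangular factor. -/
def luRest (M : GL (Fin k) ℂ) : GL (Fin k) ℂ := (luLower M)⁻¹ * M

lemma luLower_mul_luRest (M : GL (Fin k) ℂ) : luLower M * luRest M = M := by simp [luRest]

lemma luRest_mul {x y : GL (Fin k) ℂ} (hx : x ∈ uniTri (longest k)) (hy : y ∈ tri 1) :
    luRest (x * y) = y := by
  rw [luRest, luLower_mul hx hy, inv_mul_cancel_left]

lemma luLower_mem_uniTri {σ : Equiv.Perm (Fin k)} (h : M ∈ tri σ) : luLower M ∈ uniTri σ :=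
  mem_uniTri_of_mem_tri (luLower_mem_tri h) (luLower_mem M)

lemma luRest_mem_uniTri {σ : Equiv.Perm (Fin k)} (h : M ∈ uniTri σ) : luRest M ∈ uniTri σ :=
  mul_mem (inv_mem (luLower_mem_uniTri h.1)) h

lemma luRest_mem_tri_one {σ : Equiv.Perm (Fin k)} (h : M ∈ tri σ) : luRest M ∈ tri 1 :=
  luLower_inv_mul_mem (leadProd_ne_zero_of_mem_tri h)

end

/-! ### Regular dependence of the LU factors on the matrix. -/

namespace FunSpace

variable {X : Type} {A : FunSpace X} {U : Set X}

lemma IsRegMatrix.lead {M : X → Matrix (Fin k) (Fin k) ℂ} (hM : A.IsRegMatrix U M) (j : Fin k) :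
    A.IsRegMatrix U (fun x => lead (M x) j) := fun a c => hM a c

lemma IsRegMatrix.leadProd {M : X → Matrix (Fin k) (Fin k) ℂ} (hM : A.IsRegMatrix U M) :
    A.IsReg U (fun x => leadProd (M x)) :=
  IsReg.prod _ fun j _ => (hM.lead j).det

lemma IsRegMatrix.luLower {M : X → GL (Fin k) ℂ} (hU : IsOpen[A.top] U)
    (hM : A.IsRegMatrix U (fun x => (M x : Matrix (Fin k) (Fin k) ℂ)))
    (h0 : ∀ x ∈ U, SplicedFlags.leadProd (M x : Matrix (Fin k) (Fin k) ℂ) ≠ 0) :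
    A.IsRegMatrix U (fun x => (luLower (M x) : Matrix (Fin k) (Fin k) ℂ)) := by
  have hu : A.IsRegMatrix U (fun x => luUpper (M x : Matrix (Fin k) (Fin k) ℂ)) := by
    intro l j
    simp only [luUpper]
    split_ifs with h
    · exact (hM.lead j).inv hU (fun x hx => lead_det_ne_zero (h0 x hx) j) _ _
    · exact A.const _ _
  intro i j
  refine A.congr (fun x hx => ?_) (hM.mul hu i j)
  simp only [coe_luLower (h0 x hx)]

lemma IsRegMatrix.inv_gl {M : X → GL (Fin k) ℂ} (hU : IsOpen[A.top] U)
    (hM : A.IsRegMatrix U (fun x => (M x : Matrix (Fin k) (Fin k) ℂ))) :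
    A.IsRegMatrix U (fun x => (((M x)⁻¹ : GL (Fin k) ℂ) : Matrix (Fin k) (Fin k) ℂ)) := by
  simp only [Matrix.coe_units_inv]
  exact hM.inv hU fun x _ => ((Matrix.isUnit_iff_isUnit_det _).1 (M x).isUnit).ne_zero

lemma IsRegMatrix.mul_gl {M N : X → GL (Fin k) ℂ}
    (hM : A.IsRegMatrix U (fun x => (M x : Matrix (Fin k) (Fin k) ℂ)))
    (hN : A.IsRegMatrix U (fun x => (N x : Matrix (Fin k) (Fin k) ℂ))) :
    A.IsRegMatrix U (fun x => ((M x * N x : GL (Fin k) ℂ) : Matrix (Fin k) (Fin k) ℂ)) := by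
  simp only [Units.val_mul]
  exact hM.mul hN

lemma IsRegMatrix.luRest {M : X → GL (Fin k) ℂ} (hU : IsOpen[A.top] U)
    (hM : A.IsRegMatrix U (fun x => (M x : Matrix (Fin k) (Fin k) ℂ)))
    (h0 : ∀ x ∈ U, SplicedFlags.leadProd (M x : Matrix (Fin k) (Fin k) ℂ) ≠ 0) :
    A.IsRegMatrix U (fun x => (luRest (M x) : Matrix (Fin k) (Fin k) ℂ)) :=
  ((hM.luLower hU h0).inv_gl hU).mul_gl hM

end FunSpace

end Triangular

end SplicedFlags

namespace SplicedFlags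

/-! ### The tableau criterion for the Bruhat order. -/

section Bruhat

open Finset

variable {k : ℕ}

/-- Inversions of `u` inject into those of `u t`: transport a pair by `t` if it stays increasing,
and keep it otherwise. The inversion `(a, b)` is missed. -/
lemma permLength_lt_mul_swap (u : Equiv.Perm (Fin k)) {a b : Fin k} (hab : a < b)
    (hu : u a < u b) : permLength u < permLength (u * Equiv.swap a b) := by
  set t := Equiv.swap a b with ht
  have hta : t a = b := Equiv.swap_apply_left a b
  have htb : t b = a := Equiv.swap_apply_right a b
  have htt : ∀ x, t (t x) = x := Equiv.swap_apply_self a b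
  have hto : ∀ x, x ≠ a → x ≠ b → t x = x := fun x h1 h2 => Equiv.swap_apply_of_ne_of_ne h1 h2
  let φ : Fin k × Fin k → Fin k × Fin k := fun p => if t p.1 < t p.2 then (t p.1, t p.2) else p
  have hinj : Set.InjOn φ
      (univ.filter fun p : Fin k × Fin k => p.1 < p.2 ∧ u p.2 < u p.1 : Finset _) := by
    rintro ⟨p, q⟩ hp ⟨p', q'⟩ hp' h
    simp only [coe_filter, mem_univ, true_and, Set.mem_ofPred_eq] at hp hp'
    simp only [φ] at h
    split_ifs at h with h1 h2 h2
    · simpa using h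
    · obtain ⟨rfl, rfl⟩ := Prod.mk.inj h
      rw [htt, htt] at h2
      exact absurd hp.1 h2
    · obtain ⟨rfl, rfl⟩ := Prod.mk.inj h
      rw [htt, htt] at h1
      exact absurd hp'.1 h1
    · exact h
  unfold permLength
  rw [← card_image_of_injOn hinj]
  apply card_lt_card
  rw [Finset.ssubset_iff_of_subset]
  · refine ⟨(a, b), mem_filter.2 ⟨mem_univ _, hab, by
      simpa [hta, htb] using hu⟩, ?_⟩
    simp only [mem_image, mem_filter, mem_univ, true_and, Prod.exists, not_exists, not_and, φ]
    rintro p q ⟨hpq, hupq⟩ h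
    split_ifs at h with h1
    · obtain ⟨h2, h3⟩ := Prod.mk.inj h
      have h4 : p = b := by rw [← htt p, h2, hta]
      have h5 : q = a := by rw [← htt q, h3, htb]
      subst h4 h5
      exact absurd hab hpq.not_gt
    · obtain ⟨rfl, rfl⟩ := Prod.mk.inj h
      exact absurd hu hupq.not_gt
  · intro x hx
    simp only [mem_image, mem_filter, mem_univ, true_and, Prod.exists, φ] at hx ⊢
    obtain ⟨p, q, ⟨hpq, hupq⟩, rfl⟩ := hx
    split_ifs with h1
    · exact ⟨h1, by simpa [htt] using hupq⟩
    · refine ⟨hpq, ?_⟩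
      simp only [Equiv.Perm.coe_mul, Function.comp_apply]
      by_cases hpa : p = a
      · subst hpa
        by_cases hqb : q = b
        · subst hqb; exact absurd hu hupq.not_gt
        · rw [hta, hto q hpq.ne' hqb]; exact hupq.trans hu
      · by_cases hqb : q = b
        · subst hqb
          rw [htb, hto p hpa hpq.ne]; exact hu.trans hupq
        · exfalso
          by_cases hpb : p = b
          · subst hpb
            rw [htb, hto q (by rintro rfl; exact absurd hpq hab.not_gt) hqb] at h1
            exact h1 (hab.trans hpq)
          · by_cases hqa : q = a
            · subst hqa
              rw [hta, hto p hpa hpb] at h1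
              exact h1 (hpq.trans hab)
            · rw [hto p hpa hpb, hto q hqa hqb] at h1
              exact h1 hpq

/-- The number of positions before `j` where `w` takes a value at least `i`. -/
def cornerCount (w : Equiv.Perm (Fin k)) (i j : ℕ) : ℕ :=
  (univ.filter fun a : Fin k => (a : ℕ) < j ∧ i ≤ (w a : ℕ)).card

lemma permLength_le (w : Equiv.Perm (Fin k)) : permLength w ≤ k * k := by
  refine (card_le_univ _).trans ?_
  simp

/-- One step of the tableau criterion. -/
lemma exists_swap_of_cornerCount_le {u w : Equiv.Perm (Fin k)} (hne : u ≠ w)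
    (h : ∀ i j, cornerCount u i j ≤ cornerCount w i j) :
    ∃ a b : Fin k, a < b ∧ u a < u b ∧
      ∀ i j, cornerCount (u * Equiv.swap a b) i j ≤ cornerCount w i j := by
  have hex : (univ.filter fun a => u a ≠ w a).Nonempty := by
    by_contra hcon
    apply hne
    ext1 a
    by_contra ha
    exact hcon ⟨a, by simpa using ha⟩
  obtain ⟨a, ha, hmin⟩ := exists_minimal hex
  simp only [mem_filter, mem_univ, true_and] at ha hmin
  have heq : ∀ c < a, u c = w c := by
    intro c hc
    by_contra hcon
    exact absurd (hmin hcon hc.le) hc.not_ge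
  -- split the count at the position `a`
  have hsplit : ∀ (x : Equiv.Perm (Fin k)) (i j : ℕ), (a : ℕ) < j → cornerCount x i j =
      (univ.filter fun c : Fin k => c < a ∧ i ≤ (x c : ℕ)).card + (if i ≤ (x a : ℕ) then 1 else 0) +
      (univ.filter fun c : Fin k => a < c ∧ (c : ℕ) < j ∧ i ≤ (x c : ℕ)).card := by
    intro x i j hj
    unfold cornerCount
    rw [card_filter, card_filter, card_filter,
      show (if i ≤ (x a : ℕ) then 1 else 0) =
        ∑ c, if c = a then (if i ≤ (x c : ℕ) then 1 else 0) else 0 by simp]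
    rw [← sum_add_distrib, ← sum_add_distrib]
    refine sum_congr rfl fun c _ => ?_
    rcases lt_trichotomy c a with hc | rfl | hc
    · have : (c : ℕ) < j := lt_trans hc hj
      simp [hc, hc.ne, hc.not_gt, this]
    · simp [hj]
    · simp [hc, hc.ne', hc.not_gt]
  have hpre : ∀ i : ℕ, (univ.filter fun c : Fin k => c < a ∧ i ≤ (u c : ℕ)) =
      (univ.filter fun c : Fin k => c < a ∧ i ≤ (w c : ℕ)) := by
    intro i
    refine filter_congr fun c _ => and_congr_right fun hc => by rw [heq c hc]
  have hlt : u a < w a := by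
    refine lt_of_le_of_ne ?_ ha
    -- The prefixes before `a` agree, so counting values at least `u a` through position `a`
    -- compares only `u a` and `w a`.
    have h1 := h (u a) (a + 1)
    rw [hsplit u _ _ (Nat.lt_succ_self _), hsplit w _ _ (Nat.lt_succ_self _), hpre] at h1
    have h2 : ∀ x : Equiv.Perm (Fin k), (univ.filter fun c : Fin k => a < c ∧ (c : ℕ) < a + 1 ∧
        (u a : ℕ) ≤ (x c : ℕ)) = ∅ := by
      intro x
      refine filter_eq_empty_iff.2 fun c _ hc => ?_
      have := Fin.lt_def.1 hc.1
      omega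
    rw [h2, h2] at h1
    by_contra hcon
    have : ¬ ((u a : ℕ) ≤ (w a : ℕ)) := hcon
    simp [this] at h1
  have hexb : (univ.filter fun b => a < b ∧ u a < u b ∧ u b ≤ w a).Nonempty := by
    refine ⟨u.symm (w a), ?_⟩
    simp only [mem_filter, mem_univ, true_and, Equiv.apply_symm_apply, le_refl, and_true]
    refine ⟨?_, hlt⟩
    rcases lt_trichotomy a (u.symm (w a)) with h1 | h1 | h1
    · exact h1
    · exact absurd ((Equiv.eq_symm_apply u).1 h1) ha
    · have h2 := heq _ h1
      rw [Equiv.apply_symm_apply] at h2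
      exact absurd (w.injective h2) h1.ne'
  obtain ⟨b, hb, hbmin⟩ := exists_minimal hexb
  simp only [mem_filter, mem_univ, true_and] at hb hbmin
  obtain ⟨hab, huab, hubw⟩ := hb
  have hgap : ∀ c, a < c → c < b → u a < u c → w a < u c := by
    intro c hac hcb huc
    by_contra hcon
    exact absurd (hbmin ⟨hac, huc, not_lt.1 hcon⟩ hcb.le) hcb.not_ge
  refine ⟨a, b, hab, huab, fun i j => ?_⟩
  -- The swap raises the count only for `a < j ≤ b` and `u a < i ≤ u b`; slack in the inequality is
  -- needed only there.
  set u' := u * Equiv.swap a b with hu'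
  have hu'a : u' a = u b := by simp [hu']
  have hu'b : u' b = u a := by simp [hu']
  have hu'o : ∀ c, c ≠ a → c ≠ b → u' c = u c := fun c h1 h2 => by
    simp [hu', Equiv.swap_apply_of_ne_of_ne h1 h2]
  by_cases hcase : (a : ℕ) < j ∧ j ≤ b ∧ (u a : ℕ) < i ∧ i ≤ u b
  · obtain ⟨haj, hjb, hi1, hi2⟩ := hcase
    have hwi : i ≤ (w a : ℕ) := hi2.trans hubw
    -- The slack comes from the threshold `w a + 1`: it excludes position `a` on both sides, while
    -- by minimality of `b` it selects the same values of `u` between `a` and `j` as the threshold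
    -- `i` does.
    have h1 := h (w a + 1) j
    rw [hsplit u _ _ haj, hsplit w _ _ haj, hpre] at h1
    have h2 : ¬ ((w a : ℕ) + 1 ≤ u a) := by have := Fin.lt_def.1 hlt; omega
    have h3 : ¬ ((w a : ℕ) + 1 ≤ w a) := by omega
    rw [if_neg h2, if_neg h3] at h1
    have h4 : (univ.filter fun c : Fin k => a < c ∧ (c : ℕ) < j ∧ i ≤ (u' c : ℕ)) =
        univ.filter fun c : Fin k => a < c ∧ (c : ℕ) < j ∧ (w a : ℕ) + 1 ≤ (u c : ℕ) := by
      refine filter_congr fun c _ => and_congr_right fun hac => and_congr_right fun hcj => ?_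
      have hcb : c < b := Fin.lt_def.2 (by omega)
      rw [hu'o c hac.ne' hcb.ne]
      constructor
      · intro hic
        exact hgap c hac hcb (Fin.lt_def.2 (by omega))
      · intro hc; omega
    have h5 : (univ.filter fun c : Fin k => a < c ∧ (c : ℕ) < j ∧ (w a : ℕ) + 1 ≤ (w c : ℕ)).card ≤
        (univ.filter fun c : Fin k => a < c ∧ (c : ℕ) < j ∧ i ≤ (w c : ℕ)).card := by
      refine card_le_card (monotone_filter_right _ fun c _ hc => ⟨hc.1, hc.2.1, by omega⟩)
    have h6 : (univ.filter fun c : Fin k => c < a ∧ i ≤ (u' c : ℕ)) =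
        (univ.filter fun c : Fin k => c < a ∧ i ≤ (w c : ℕ)) := by
      rw [← hpre]
      refine filter_congr fun c _ => and_congr_right fun hc => ?_
      rw [hu'o c hc.ne (hc.trans hab).ne]
    rw [hsplit u' _ _ haj, hsplit w _ _ haj, h4, h6, hu'a, if_pos hi2, if_pos hwi]
    omega
  · refine le_trans ?_ (h i j)
    unfold cornerCount
    by_cases hbj : (b : ℕ) < j
    -- Both swapped positions precede `j`, so the swap merely permutes the counted ones.
    · refine card_le_card_of_injOn (Equiv.swap a b) ?_ (Equiv.injective _).injOn
      intro c hc
      simp only [coe_filter, mem_univ, true_and, Set.mem_ofPred_eq] at hc ⊢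
      refine ⟨?_, by simpa [hu'] using hc.2⟩
      have := Fin.lt_def.1 hab
      rw [Equiv.swap_apply_def]
      split_ifs
      · exact hbj
      · omega
      · exact hc.1
    · refine card_le_card fun c hc => ?_
      simp only [mem_filter, mem_univ, true_and] at hc ⊢
      refine ⟨hc.1, ?_⟩
      have hcb : c ≠ b := by rintro rfl; omega
      by_cases hca : c = a
      · subst hca
        rw [hu'a] at hc
        by_contra hcon
        exact hcase ⟨hc.1, by omega, by omega, hc.2⟩
      · rw [hu'o c hca hcb] at hc
        exact hc.2

/-- The tableau criterion for the Bruhat order. -/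
lemma bruhatLE_of_cornerCount_le {u w : Equiv.Perm (Fin k)}
    (h : ∀ i j, cornerCount u i j ≤ cornerCount w i j) : BruhatLE u w := by
  -- Each swap raises the length, which is at most `k * k`.
  induction hn : k * k - permLength u using Nat.strong_induction_on generalizing u with
  | _ n ih =>
    by_cases hne : u = w
    · subst hne; exact Relation.ReflTransGen.refl
    · obtain ⟨a, b, hab, hu, h'⟩ := exists_swap_of_cornerCount_le hne h
      have hlen := permLength_lt_mul_swap u hab hu
      have hle := permLength_le (u * Equiv.swap a b)
      exact Relation.ReflTransGen.head ⟨a, b, hab.ne, rfl, hlen⟩ (ih _ (by omega) h' rfl)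

end Bruhat

end SplicedFlags

namespace SplicedFlags

/-! ### Permutation matrices, relative positions and open cells. -/

variable {k : ℕ}

/-- Permutation matrices: `permGL w` maps `e_j` to `e_{w j}`. -/
def permGL : Equiv.Perm (Fin k) →* GL (Fin k) ℂ :=
  MonoidHom.toHomUnits
    { toFun := fun w => Matrix.of fun i j => if i = w j then 1 else 0
      map_one' := by ext i j; simp only [Matrix.of_apply, Equiv.Perm.one_apply, Matrix.one_apply]; rfl
      map_mul' := fun v w => by ext i j; simp [Matrix.mul_apply]; rfl }

lemma permGL_apply (w : Equiv.Perm (Fin k)) (i j : Fin k) :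
    permGL w i j = if i = w j then (1 : ℂ) else 0 := rfl

lemma permGL_mul_apply (v : Equiv.Perm (Fin k)) (M : GL (Fin k) ℂ) (i j : Fin k) :
    (permGL v * M : GL (Fin k) ℂ) i j = M (v⁻¹ i) j := by
  rw [Units.val_mul, Matrix.mul_apply, Finset.sum_eq_single (v⁻¹ i)]
  · simp [permGL_apply]
  · intro l _ hl
    rw [permGL_apply, if_neg (by rintro rfl; simp at hl), zero_mul]
  · simp

lemma mul_permGL_apply (v : Equiv.Perm (Fin k)) (M : GL (Fin k) ℂ) (i j : Fin k) :
    (M * permGL v : GL (Fin k) ℂ) i j = M i (v j) := by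
  simp [Units.val_mul, Matrix.mul_apply, permGL_apply]

lemma conj_permGL_apply (v : Equiv.Perm (Fin k)) (M : GL (Fin k) ℂ) (i j : Fin k) :
    ((permGL v)⁻¹ * M * permGL v : GL (Fin k) ℂ) i j = M (v i) (v j) := by
  rw [mul_permGL_apply, ← map_inv, permGL_mul_apply, inv_inv]

lemma conj_permGL_mem_tri {σ v : Equiv.Perm (Fin k)} {g : GL (Fin k) ℂ} :
    (permGL v)⁻¹ * g * permGL v ∈ tri σ ↔ g ∈ tri (σ * v⁻¹) := by
  simp only [mem_tri, conj_permGL_apply]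
  refine ⟨fun h i j hij => ?_, fun h i j hij => h _ _ (by simpa using hij)⟩
  simpa using h (v⁻¹ i) (v⁻¹ j) hij

lemma conj_permGL_mem_uniTri {σ v : Equiv.Perm (Fin k)} {g : GL (Fin k) ℂ} :
    (permGL v)⁻¹ * g * permGL v ∈ uniTri σ ↔ g ∈ uniTri (σ * v⁻¹) := by
  simp only [mem_uniTri, conj_permGL_mem_tri, conj_permGL_apply]
  refine and_congr_right fun _ => ⟨fun h i => ?_, fun h i => h _⟩
  simpa using h (v⁻¹ i)

namespace CFlag

lemma act_ofMatrix (g M : GL (Fin k) ℂ) : act g (ofMatrix M) = ofMatrix (g * M) := by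
  ext1
  funext i
  simp only [act, ofMatrix, ofVectors, Submodule.map_span, ← Set.image_comp]
  congr 2

lemma coord_eq_ofMatrix (w : Equiv.Perm (Fin k)) : coord w = ofMatrix (permGL w) := by
  ext1
  funext i
  simp only [coord, ofMatrix, ofVectors]
  congr 2
  funext j l
  simp [permGL_apply, Pi.single_apply]

lemma mem_sub_ofMatrix (M : GL (Fin k) ℂ) {i : Fin (k + 1)} {j : Fin k} (h : (j : ℕ) < i) :
    (fun l => M l j) ∈ (ofMatrix M).sub i :=
  Submodule.subset_span ⟨j, h, rfl⟩

lemma apply_eq_zero_of_mem_sub_one {i : Fin (k + 1)} {x : Fin k → ℂ}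
    (hx : x ∈ (ofMatrix (1 : GL (Fin k) ℂ)).sub i) {l : Fin k} (hl : (i : ℕ) ≤ l) : x l = 0 := by
  have : (ofMatrix (1 : GL (Fin k) ℂ)).sub i ≤
      LinearMap.ker (LinearMap.proj l : (Fin k → ℂ) →ₗ[ℂ] ℂ) := by
    refine Submodule.span_le.2 ?_
    rintro _ ⟨j, hj, rfl⟩
    have : l ≠ j := by rintro rfl; exact absurd hj (not_lt.2 hl)
    simp [Matrix.one_apply, this]
  exact this hx

lemma ext_of_le {F G : CFlag k} (h : ∀ i, F.sub i ≤ G.sub i) : F = G := by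
  ext1
  funext i
  exact Submodule.eq_of_le_of_finrank_eq (h i) (by rw [F.finrank_sub, G.finrank_sub])

lemma ofMatrix_mul_of_mem_tri (M : GL (Fin k) ℂ) {b : GL (Fin k) ℂ} (hb : b ∈ tri 1) :
    ofMatrix (M * b) = ofMatrix M := by
  refine ext_of_le fun i => Submodule.span_le.2 ?_
  rintro _ ⟨j, hj, rfl⟩
  have : (fun l => (M * b : GL (Fin k) ℂ) l j) = ∑ c, b c j • (fun l => M l c) := by
    ext l
    simp [Matrix.mul_apply, mul_comm]
  change (fun l => (M * b : GL (Fin k) ℂ) l j) ∈ _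
  rw [this]
  refine Submodule.sum_mem _ fun c _ => ?_
  by_cases hc : c ≤ j
  · exact Submodule.smul_mem _ _ (mem_sub_ofMatrix M (lt_of_le_of_lt hc hj))
  · rw [mem_tri.1 hb c j (by simpa using hc), zero_smul]
    exact Submodule.zero_mem _

/-- The stabilizer of the standard flag is the upper Borel subgroup: column `j` must lie in the
standard subspace of dimension `j + 1` (0-based). -/
lemma ofMatrix_eq_iff {M N : GL (Fin k) ℂ} : ofMatrix M = ofMatrix N ↔ M⁻¹ * N ∈ tri 1 := by
  constructor
  · intro h
    have h1 : ofMatrix (1 : GL (Fin k) ℂ) = ofMatrix (M⁻¹ * N) := by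
      rw [← act_ofMatrix, ← h, act_ofMatrix, inv_mul_cancel]
    refine mem_tri.2 fun i j hij => ?_
    have h2 := mem_sub_ofMatrix (M⁻¹ * N) (i := j.succ) (j := j) (by simp)
    rw [← h1] at h2
    exact apply_eq_zero_of_mem_sub_one h2 (by simpa using hij)
  · intro h
    rw [← ofMatrix_mul_of_mem_tri M h, mul_inv_cancel_left]

lemma relPos_iff {w : Equiv.Perm (Fin k)} {F G : CFlag k} :
    RelPos w F G ↔ ∃ g, F = ofMatrix g ∧ G = ofMatrix (g * permGL w) := by
  have key : ∀ (g : GL (Fin k) ℂ) (F : CFlag k) (M : GL (Fin k) ℂ),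
      act g F = ofMatrix M ↔ F = ofMatrix (g⁻¹ * M) := by
    intro g F M
    constructor
    · intro h
      rw [← act_ofMatrix, ← h]
      ext1
      funext i
      simp only [act, ← Submodule.map_comp]
      rw [← Matrix.mulVecLin_mul, ← Units.val_mul, inv_mul_cancel]
      simp
    · rintro rfl
      rw [act_ofMatrix, mul_inv_cancel_left]
  unfold RelPos
  rw [std, coord_eq_ofMatrix, coord_eq_ofMatrix, map_one]
  constructor
  · rintro ⟨g, h1, h2⟩
    exact ⟨g⁻¹, by simpa using (key _ _ _).1 h1, (key _ _ _).1 h2⟩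
  · rintro ⟨g, h1, h2⟩
    exact ⟨g⁻¹, (key _ _ _).2 (by simpa using h1), (key _ _ _).2 (by simpa using h2)⟩

/-- The orbit of the coordinate flag `F(w)` under `tri σ`. -/
def orbit (σ w : Equiv.Perm (Fin k)) : Set (CFlag k) :=
  {F | ∃ b ∈ tri σ, F = ofMatrix (b * permGL w)}

lemma ofMatrix_mul_mem_orbit {σ w : Equiv.Perm (Fin k)} {g M : GL (Fin k) ℂ} (hg : g ∈ tri σ)
    (hM : ofMatrix M ∈ orbit σ w) : ofMatrix (g * M) ∈ orbit σ w := by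
  obtain ⟨b, hb, h⟩ := hM
  exact ⟨g * b, mul_mem hg hb, by rw [← act_ofMatrix, h, act_ofMatrix, mul_assoc]⟩

lemma relPos_std_iff {w : Equiv.Perm (Fin k)} {F : CFlag k} :
    RelPos w (std k) F ↔ F ∈ orbit 1 w := by
  rw [relPos_iff, std, coord_eq_ofMatrix, map_one]
  simp only [ofMatrix_eq_iff, inv_one, one_mul]
  rfl

lemma longest_inv : (longest k)⁻¹ = longest k := rfl

/-- Conjugation by `w₀` turns the upper Borel subgroup into the lower one, the stabilizer of the
antistandard flag. -/
lemma relPos_ant_iff {u : Equiv.Perm (Fin k)} {F : CFlag k} :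
    RelPos (u⁻¹ * longest k) F (ant k) ↔ F ∈ orbit (longest k) u := by
  have key : ∀ g : GL (Fin k) ℂ, (ant k = ofMatrix (g * permGL (u⁻¹ * longest k)) ↔
      g * (permGL u)⁻¹ ∈ tri (longest k)) := by
    intro g
    have := conj_permGL_mem_tri (σ := 1) (v := longest k) (g := g * (permGL u)⁻¹)
    rw [one_mul, longest_inv] at this
    rw [ant, coord_eq_ofMatrix, ofMatrix_eq_iff, ← this, map_mul, map_inv]
    simp only [mul_assoc]
  rw [relPos_iff]
  constructor
  · rintro ⟨g, rfl, h⟩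
    exact ⟨_, (key g).1 h, by simp⟩
  · rintro ⟨b, hb, rfl⟩
    exact ⟨_, rfl, (key _).2 (by simpa using hb)⟩

lemma richardson_eq (u w : Equiv.Perm (Fin k)) :
    richardson u w = orbit 1 w ∩ orbit (longest k) u :=
  Set.ext fun _ => and_congr relPos_std_iff relPos_ant_iff

/-- The flags transverse to `F(v w₀)`: an open cell centered at `F(v)`. -/
def bigCell (v : Equiv.Perm (Fin k)) : Set (CFlag k) :=
  {F | ∃ M : GL (Fin k) ℂ, F = ofMatrix M ∧
    leadProd (((permGL v)⁻¹ * M : GL (Fin k) ℂ) : Matrix (Fin k) (Fin k) ℂ) ≠ 0}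

lemma ofMatrix_mem_bigCell {v : Equiv.Perm (Fin k)} {M : GL (Fin k) ℂ} :
    ofMatrix M ∈ bigCell v ↔
      leadProd (((permGL v)⁻¹ * M : GL (Fin k) ℂ) : Matrix (Fin k) (Fin k) ℂ) ≠ 0 := by
  refine ⟨?_, fun h => ⟨M, rfl, h⟩⟩
  rintro ⟨N, hN, h⟩
  have hb := ofMatrix_eq_iff.1 hN.symm
  rw [show (permGL v)⁻¹ * M = ((permGL v)⁻¹ * N) * (N⁻¹ * M) by group, Units.val_mul,
    leadProd_mul _ hb]
  exact mul_ne_zero h (leadProd_ne_zero_of_mem_tri hb)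

lemma luLower_mul_of_mem_tri {M b : GL (Fin k) ℂ}
    (h : leadProd (M : Matrix (Fin k) (Fin k) ℂ) ≠ 0) (hb : b ∈ tri 1) :
    luLower (M * b) = luLower M := by
  conv_lhs => rw [← luLower_mul_luRest M, mul_assoc]
  exact luLower_mul (luLower_mem M) (mul_mem (luLower_inv_mul_mem h) hb)

open Classical in
/-- The unique `g ∈ v U₋ v⁻¹` with `F = g F(v)`, for `F` in the open cell at `F(v)`. -/
def cellRep (v : Equiv.Perm (Fin k)) (F : CFlag k) : GL (Fin k) ℂ :=
  if h : F ∈ bigCell v then permGL v * luLower ((permGL v)⁻¹ * h.choose) * (permGL v)⁻¹ else 1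

lemma cellRep_ofMatrix {v : Equiv.Perm (Fin k)} {M : GL (Fin k) ℂ} (h : ofMatrix M ∈ bigCell v) :
    cellRep v (ofMatrix M) = permGL v * luLower ((permGL v)⁻¹ * M) * (permGL v)⁻¹ := by
  rw [cellRep, dif_pos h]
  -- Two representatives differ by an upper triangular right factor, which the lower LU factor
  -- ignores.
  have hb := ofMatrix_eq_iff.1 h.choose_spec.1.symm
  congr 2
  conv_rhs => rw [show (permGL v)⁻¹ * M = ((permGL v)⁻¹ * h.choose) * (h.choose⁻¹ * M) by group]
  exact (luLower_mul_of_mem_tri h.choose_spec.2 hb).symm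

lemma cellRep_mem (v : Equiv.Perm (Fin k)) (F : CFlag k) :
    cellRep v F ∈ uniTri (longest k * v⁻¹) := by
  unfold cellRep
  split_ifs with h
  · rw [← conj_permGL_mem_uniTri]
    simpa [mul_assoc] using luLower_mem _
  · exact one_mem _

lemma ofMatrix_cellRep {v : Equiv.Perm (Fin k)} {F : CFlag k} (h : F ∈ bigCell v) :
    ofMatrix (cellRep v F * permGL v) = F := by
  obtain ⟨M, rfl, hM⟩ := h
  rw [cellRep_ofMatrix (ofMatrix_mem_bigCell.2 hM), inv_mul_cancel_right, ofMatrix_eq_iff]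
  simpa [mul_assoc] using luLower_inv_mul_mem hM

/-- Conjugation by `v` only changes the order for which `g` is triangular, and any order gives
nonzero leading minors. -/
lemma ofMatrix_mem_bigCell_of_mem_tri {v σ : Equiv.Perm (Fin k)} {g : GL (Fin k) ℂ}
    (hg : g ∈ tri σ) : ofMatrix (g * permGL v) ∈ bigCell v := by
  rw [ofMatrix_mem_bigCell, ← mul_assoc]
  exact leadProd_ne_zero_of_mem_tri (conj_permGL_mem_tri (σ := σ * v).2 (by simpa using hg))

lemma cellRep_ofMatrix_mul {v : Equiv.Perm (Fin k)} {g : GL (Fin k) ℂ}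
    (hg : g ∈ uniTri (longest k * v⁻¹)) : cellRep v (ofMatrix (g * permGL v)) = g := by
  rw [cellRep_ofMatrix (ofMatrix_mem_bigCell_of_mem_tri hg.1), ← mul_assoc]
  have := luLower_mul (conj_permGL_mem_uniTri.2 hg) (one_mem (tri 1))
  rw [mul_one] at this
  rw [this]
  group

lemma orbit_subset_bigCell (σ v : Equiv.Perm (Fin k)) : orbit σ v ⊆ bigCell v := by
  rintro _ ⟨b, hb, rfl⟩
  exact ofMatrix_mem_bigCell_of_mem_tri hb

/-- For `σ = 1` or `σ = w₀` this makes the representative upper or lower triangular, as recovering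
the splicing components requires. -/
lemma cellRep_mem_tri {σ v : Equiv.Perm (Fin k)} {F : CFlag k} (h : F ∈ orbit σ v) :
    cellRep v F ∈ tri σ := by
  have hF := orbit_subset_bigCell σ v h
  obtain ⟨b, hb, rfl⟩ := h
  have := luLower_mem_tri (conj_permGL_mem_tri (σ := σ * v).2
    (show b ∈ tri (σ * v * v⁻¹) by simpa using hb))
  rw [mul_assoc] at this
  rw [cellRep_ofMatrix hF, ← mul_inv_cancel_right σ v, ← conj_permGL_mem_tri]
  simpa [mul_assoc] using this

lemma transverse_iff {v : Equiv.Perm (Fin k)} {F : CFlag k} :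
    Transverse F (coord (v * longest k)) ↔ F ∈ bigCell v := by
  have key : ∀ g : GL (Fin k) ℂ, (coord (v * longest k) = ofMatrix (g * permGL (longest k)) ↔
      (permGL v)⁻¹ * g ∈ tri (longest k)) := by
    intro g
    have := conj_permGL_mem_tri (σ := 1) (v := longest k) (g := (permGL v)⁻¹ * g)
    rw [one_mul, longest_inv] at this
    rw [coord_eq_ofMatrix, ofMatrix_eq_iff, ← this, map_mul, mul_inv_rev]
    simp only [mul_assoc]
  rw [Transverse, relPos_iff]
  constructor
  · rintro ⟨g, rfl, h⟩
    exact ofMatrix_mem_bigCell.2 (leadProd_ne_zero_of_mem_tri ((key g).1 h))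
  · intro h
    refine ⟨_, (ofMatrix_cellRep h).symm, (key _).2 ?_⟩
    rw [← mul_assoc]
    exact conj_permGL_mem_tri.2 (cellRep_mem v F).1

lemma splicingSet_eq (u v w : Equiv.Perm (Fin k)) :
    splicingSet u v w = richardson u w ∩ bigCell v :=
  Set.ext fun _ => and_congr_right fun _ => transverse_iff

/-! ### Nonempty Richardson varieties -/

/-- Inside `F_j`, the columns with `w a < i` are supported on the coordinates below `i`, and those
with `u a ≥ i` on the rest. The two spans are independent, so their dimensions add up to at most
`dim F_j`. -/
lemma cornerCount_le_of_mem {u w : Equiv.Perm (Fin k)} {F : CFlag k} (hw : F ∈ orbit 1 w)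
    (hu : F ∈ orbit (longest k) u) (i j : ℕ) : cornerCount u i j ≤ cornerCount w i j := by
  obtain ⟨b, hb, hF⟩ := hw
  obtain ⟨c, hc, hF'⟩ := hu
  -- The natural number `j` may exceed `k`, where the flag ends.
  let j' : Fin (k + 1) := ⟨min j k, by omega⟩
  have hspan : ∀ (M : GL (Fin k) ℂ) (p : Fin k → Prop) [DecidablePred p],
      Module.finrank ℂ (Submodule.span ℂ (Set.range fun a : {a // p a} => fun l => M l a.1)) =
        (Finset.univ.filter p).card := by
    intro M p _
    rw [finrank_span_eq_card, Fintype.card_subtype]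
    exact (Matrix.linearIndependent_cols_of_isUnit M.isUnit).comp _ Subtype.val_injective
  have hle : ∀ (M : GL (Fin k) ℂ) (p : Fin k → Prop), (∀ a, p a → (a : ℕ) < j) →
      F = ofMatrix M →
      Submodule.span ℂ (Set.range fun a : {a // p a} => fun l => M l a.1) ≤ F.sub j' := by
    rintro M p hp rfl
    refine Submodule.span_le.2 ?_
    rintro _ ⟨a, rfl⟩
    exact mem_sub_ofMatrix M (lt_min (hp a a.2) a.1.2)
  set A := Submodule.span ℂ (Set.range fun a : {a : Fin k // (a : ℕ) < j ∧ (w a : ℕ) < i} =>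
    fun l => (b * permGL w : GL (Fin k) ℂ) l a.1) with hA
  set B := Submodule.span ℂ (Set.range fun a : {a : Fin k // (a : ℕ) < j ∧ i ≤ (u a : ℕ)} =>
    fun l => (c * permGL u : GL (Fin k) ℂ) l a.1) with hB
  have hA0 : ∀ x ∈ A, ∀ l : Fin k, i ≤ l → x l = 0 := by
    intro x hx l hl
    have : A ≤ LinearMap.ker (LinearMap.proj l : (Fin k → ℂ) →ₗ[ℂ] ℂ) := by
      refine Submodule.span_le.2 ?_
      rintro _ ⟨a, rfl⟩
      have := mem_tri.1 hb l (w a) (Fin.lt_def.2 (lt_of_lt_of_le a.2.2 hl))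
      simpa [mul_permGL_apply, -Units.val_mul] using this
    exact this hx
  have hB0 : ∀ x ∈ B, ∀ l : Fin k, (l : ℕ) < i → x l = 0 := by
    intro x hx l hl
    have : B ≤ LinearMap.ker (LinearMap.proj l : (Fin k → ℂ) →ₗ[ℂ] ℂ) := by
      refine Submodule.span_le.2 ?_
      rintro _ ⟨a, rfl⟩
      have := mem_tri.1 hc l (u a) (by simpa [longest] using lt_of_lt_of_le hl a.2.2)
      simpa [mul_permGL_apply, -Units.val_mul] using this
    exact this hx
  have hAB : A ⊓ B = ⊥ := by
    refine (Submodule.eq_bot_iff _).2 fun x hx => ?_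
    ext l
    rcases lt_or_ge (l : ℕ) i with h | h
    · exact hB0 x hx.2 l h
    · exact hA0 x hx.1 l h
  have hsum := Submodule.finrank_sup_add_finrank_inf_eq A B
  rw [hAB, finrank_bot, add_zero, hspan, hspan] at hsum
  have hsup : Module.finrank ℂ ↥(A ⊔ B) ≤ min j k := by
    rw [← show Module.finrank ℂ (F.sub j') = min j k from F.finrank_sub j']
    exact Submodule.finrank_mono (sup_le (hle _ _ (fun a h => h.1) hF)
      (hle _ _ (fun a h => h.1) hF'))
  have hj : min j k = (Finset.univ.filter fun a : Fin k => (a : ℕ) < j).card := by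
    rw [Fin.card_filter_val_lt, min_comm]
  have hcount := Finset.card_filter_add_card_filter_not
    (s := Finset.univ.filter fun a : Fin k => (a : ℕ) < j) (fun a => (w a : ℕ) < i)
  rw [Finset.filter_filter, Finset.filter_filter] at hcount
  simp only [not_lt] at hcount
  unfold cornerCount
  omega

lemma bruhatLE_of_mem_richardson {u w : Equiv.Perm (Fin k)} {F : CFlag k}
    (h : F ∈ richardson u w) : BruhatLE u w := by
  rw [richardson_eq] at h
  exact bruhatLE_of_cornerCount_le (cornerCount_le_of_mem h.1 h.2)

/-! ### Regularity -/

section Regular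

variable {X : Type} {A : FunSpace X}

lemma isRegMatrix_glSpace (U : Set (GL (Fin k) ℂ)) (hU : IsOpen[(glSpace k).top] U) :
    (glSpace k).IsRegMatrix U (fun M => (M : Matrix (Fin k) (Fin k) ℂ)) := fun i j =>
  (glSpace k).mono hU (Set.subset_univ _)
    ((FunSpace.isMorphism_induced_val _ (FunSpace.affine (Fin k × Fin k)) Set.univ
      (FunSpace.affine _).top.isOpen_univ).2 _ (FunSpace.isReg_coordinate _ (i, j)))

/-- A regular lift to matrices is enough to prove that a map to flags is a morphism. -/
lemma isMorphism_ofMatrix {M : X → GL (Fin k) ℂ}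
    (hM : A.IsRegMatrix Set.univ (fun x => (M x : Matrix (Fin k) (Fin k) ℂ))) :
    A.IsMorphism (flagVariety k) (fun x => ofMatrix (M x)) :=
  (FunSpace.isMorphism_quotient ofMatrix (glSpace k)).comp
    (FunSpace.IsMorphism.to_induced (FunSpace.isMorphism_affine fun s => hM s.1 s.2))

lemma isMorphism_subvariety {S : Set (CFlag k)} {φ : X → S} {M : X → GL (Fin k) ℂ}
    (hφ : ∀ x, (φ x : CFlag k) = ofMatrix (M x))
    (hM : A.IsRegMatrix Set.univ (fun x => (M x : Matrix (Fin k) (Fin k) ℂ))) :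
    A.IsMorphism (subvariety S) φ := by
  refine FunSpace.IsMorphism.to_induced ?_
  rw [show Subtype.val ∘ φ = fun x => ofMatrix (M x) from funext hφ]
  exact isMorphism_ofMatrix hM

lemma isOpen_bigCell (v : Equiv.Perm (Fin k)) : IsOpen[(flagVariety k).top] (bigCell v) := by
  have huniv : IsOpen[(glSpace k).top] Set.univ := (glSpace k).top.isOpen_univ
  have h := (glSpace k).isOpen_ne huniv (((FunSpace.isRegMatrix_const
    (((permGL v)⁻¹ : GL (Fin k) ℂ) : Matrix (Fin k) (Fin k) ℂ)).mul_gl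
      (isRegMatrix_glSpace _ huniv)).leadProd)
  change IsOpen[(glSpace k).top] (ofMatrix ⁻¹' bigCell v)
  convert h using 1
  ext M
  simp only [Set.mem_preimage, ofMatrix_mem_bigCell]
  simp

/-- Regularity on the quotient is tested after pullback to `GL`, where `cellRep` is given by the LU
formula. -/
lemma isRegMatrix_cellRep (v : Equiv.Perm (Fin k)) {S : Set (CFlag k)} (hS : S ⊆ bigCell v) :
    (subvariety S).IsRegMatrix Set.univ
      (fun F => (cellRep v F.1 : Matrix (Fin k) (Fin k) ℂ)) := by
  intro i j F _
  refine ⟨bigCell v, isOpen_bigCell v, hS F.2, fun F => cellRep v F i j, ?_, fun _ _ _ => rfl⟩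
  have hU : IsOpen[(glSpace k).top] (ofMatrix ⁻¹' bigCell v) := isOpen_bigCell v
  have hM : (glSpace k).IsRegMatrix (ofMatrix ⁻¹' bigCell v) _ :=
    (FunSpace.isRegMatrix_const (((permGL v)⁻¹ : GL (Fin k) ℂ) : Matrix (Fin k) (Fin k) ℂ)).mul_gl
      (isRegMatrix_glSpace _ hU)
  have hL := hM.luLower hU fun M hM => ofMatrix_mem_bigCell.1 hM
  have := ((FunSpace.isRegMatrix_const (A := glSpace k) (U := ofMatrix ⁻¹' bigCell v)
    (permGL v : Matrix (Fin k) (Fin k) ℂ)).mul_gl hL).mul_gl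
    (FunSpace.isRegMatrix_const (((permGL v)⁻¹ : GL (Fin k) ℂ) : Matrix (Fin k) (Fin k) ℂ))
  refine (glSpace k).congr (fun M hM => ?_) (this i j)
  simp only [Function.comp_apply, cellRep_ofMatrix hM]

end Regular

end CFlag

end SplicedFlags

namespace SplicedFlags

namespace CFlag

/-! ### The splicing map, its inverse, and the theorem. -/

variable {k : ℕ} {u v w : Equiv.Perm (Fin k)}

/-- The component of the splicing map in `R(u, v)`: the factor `R` of `g = L R`. -/
def spliceFst (v : Equiv.Perm (Fin k)) (F : CFlag k) : GL (Fin k) ℂ := luRest (cellRep v F)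

/-- The component of the splicing map in `R(v, w)`: the lower factor of `g = R' L'`. -/
def spliceSnd (v : Equiv.Perm (Fin k)) (F : CFlag k) : GL (Fin k) ℂ :=
  (luLower (cellRep v F)⁻¹)⁻¹

/-- The inverse of the splicing map. -/
def unsplice (v : Equiv.Perm (Fin k)) (F G : CFlag k) : GL (Fin k) ℂ :=
  luRest (cellRep v F * (cellRep v G)⁻¹) * cellRep v G

lemma spliceFst_mem (v : Equiv.Perm (Fin k)) (F : CFlag k) :
    spliceFst v F ∈ uniTri (longest k * v⁻¹) := luRest_mem_uniTri (cellRep_mem v F)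

lemma spliceSnd_mem (v : Equiv.Perm (Fin k)) (F : CFlag k) :
    spliceSnd v F ∈ uniTri (longest k * v⁻¹) :=
  inv_mem (luLower_mem_uniTri (inv_mem (cellRep_mem v F)).1)

lemma unsplice_mem (v : Equiv.Perm (Fin k)) (F G : CFlag k) :
    unsplice v F G ∈ uniTri (longest k * v⁻¹) :=
  mul_mem (luRest_mem_uniTri (mul_mem (cellRep_mem v F) (inv_mem (cellRep_mem v G))))
    (cellRep_mem v G)

/-- Here `R F(v)` has `R` upper triangular, and it equals `L⁻¹ F`, with `L⁻¹` lower triangular. -/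
lemma ofMatrix_spliceFst_mem {F : CFlag k} (hF : F ∈ splicingSet u v w) :
    ofMatrix (spliceFst v F * permGL v) ∈ richardson u v := by
  rw [splicingSet_eq, richardson_eq] at hF
  rw [richardson_eq]
  refine ⟨⟨_, luRest_mem_tri_one (cellRep_mem v F).1, rfl⟩, ?_⟩
  rw [spliceFst, luRest, mul_assoc]
  refine ofMatrix_mul_mem_orbit (inv_mem (luLower_mem _).1) ?_
  rw [ofMatrix_cellRep hF.2]
  exact hF.1.2

/-- Dually, the factor itself is lower triangular, and it differs from `g` by an upper triangular
left factor. -/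
lemma ofMatrix_spliceSnd_mem {F : CFlag k} (hF : F ∈ splicingSet u v w) :
    ofMatrix (spliceSnd v F * permGL v) ∈ richardson v w := by
  rw [splicingSet_eq, richardson_eq] at hF
  rw [richardson_eq]
  refine ⟨?_, ⟨_, inv_mem (luLower_mem _).1, rfl⟩⟩
  rw [show spliceSnd v F = luRest (cellRep v F)⁻¹ * cellRep v F by simp [spliceSnd, luRest],
    mul_assoc]
  refine ofMatrix_mul_mem_orbit (luRest_mem_tri_one (inv_mem (cellRep_mem v F)).1) ?_
  rw [ofMatrix_cellRep hF.2]
  exact hF.1.1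

lemma ofMatrix_unsplice_mem {F G : CFlag k} (hF : F ∈ richardson u v) (hG : G ∈ richardson v w) :
    ofMatrix (unsplice v F G * permGL v) ∈ splicingSet u v w := by
  rw [richardson_eq] at hF hG
  rw [splicingSet_eq, richardson_eq]
  have hFc := orbit_subset_bigCell _ _ hF.1
  have hGc := orbit_subset_bigCell _ _ hG.2
  refine ⟨⟨?_, ?_⟩, ofMatrix_mem_bigCell_of_mem_tri (unsplice_mem v F G).1⟩
  · rw [unsplice, mul_assoc]
    refine ofMatrix_mul_mem_orbit (luRest_mem_tri_one
      (mul_mem (cellRep_mem v F) (inv_mem (cellRep_mem v G))).1) ?_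
    rw [ofMatrix_cellRep hGc]
    exact hG.1
  · rw [show unsplice v F G = (luLower (cellRep v F * (cellRep v G)⁻¹))⁻¹ * cellRep v F by
      simp [unsplice, luRest, mul_assoc], mul_assoc]
    refine ofMatrix_mul_mem_orbit (inv_mem (luLower_mem _).1) ?_
    rw [ofMatrix_cellRep hFc]
    exact hF.2

lemma unsplice_splice {F : CFlag k} (hF : F ∈ bigCell v) :
    ofMatrix (unsplice v (ofMatrix (spliceFst v F * permGL v))
      (ofMatrix (spliceSnd v F * permGL v)) * permGL v) = F := by
  rw [unsplice, cellRep_ofMatrix_mul (spliceFst_mem v F), cellRep_ofMatrix_mul (spliceSnd_mem v F)]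
  -- This is `R L'⁻¹ = L⁻¹ R'`, whose right side is already an LU factorization.
  have h : spliceFst v F * (spliceSnd v F)⁻¹ =
      (luLower (cellRep v F))⁻¹ * (luRest (cellRep v F)⁻¹)⁻¹ := by
    simp [spliceFst, spliceSnd, luRest, mul_assoc]
  rw [h, luRest_mul (inv_mem (luLower_mem _))
    (inv_mem (luRest_mem_tri_one (inv_mem (cellRep_mem v F)).1)), spliceSnd, ← mul_inv_rev,
    luLower_mul_luRest, inv_inv, ofMatrix_cellRep hF]

lemma spliceFst_unsplice {F G : CFlag k} (hF : F ∈ orbit 1 v) :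
    ofMatrix (spliceFst v (ofMatrix (unsplice v F G * permGL v)) * permGL v) = F := by
  rw [spliceFst, cellRep_ofMatrix_mul (unsplice_mem v F G),
    show unsplice v F G = (luLower (cellRep v F * (cellRep v G)⁻¹))⁻¹ * cellRep v F by
      simp [unsplice, luRest, mul_assoc],
    luRest_mul (inv_mem (luLower_mem _)) (cellRep_mem_tri hF),
    ofMatrix_cellRep (orbit_subset_bigCell _ _ hF)]

lemma spliceSnd_unsplice {F G : CFlag k} (hG : G ∈ orbit (longest k) v) :
    ofMatrix (spliceSnd v (ofMatrix (unsplice v F G * permGL v)) * permGL v) = G := by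
  rw [spliceSnd, cellRep_ofMatrix_mul (unsplice_mem v F G), unsplice, mul_inv_rev,
    luLower_mul (inv_mem (mem_uniTri_of_mem_tri (cellRep_mem_tri hG) (cellRep_mem v G)))
      (inv_mem (luRest_mem_tri_one (mul_mem (cellRep_mem v F) (inv_mem (cellRep_mem v G))).1)),
    inv_inv, ofMatrix_cellRep (orbit_subset_bigCell _ _ hG)]

/-- The splicing bijection. -/
def spliceEquiv (u v w : Equiv.Perm (Fin k)) :
    splicingSet u v w ≃ richardson u v × richardson v w where
  toFun F := (⟨_, ofMatrix_spliceFst_mem F.2⟩, ⟨_, ofMatrix_spliceSnd_mem F.2⟩)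
  invFun z := ⟨_, ofMatrix_unsplice_mem z.1.2 z.2.2⟩
  left_inv F := Subtype.ext (unsplice_splice ((splicingSet_eq u v w).subset F.2).2)
  right_inv z := Prod.ext
    (Subtype.ext (spliceFst_unsplice ((richardson_eq u v).subset z.1.2).1))
    (Subtype.ext (spliceSnd_unsplice ((richardson_eq v w).subset z.2.2).2))

theorem isomorphic_splicingSet (u v w : Equiv.Perm (Fin k)) :
    (subvariety (splicingSet u v w)).Isomorphic
      ((subvariety (richardson u v)).prod (subvariety (richardson v w))) := by
  have hS : splicingSet u v w ⊆ bigCell v := fun F hF => ((splicingSet_eq u v w).subset hF).2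
  have h1 : richardson u v ⊆ bigCell v := fun F hF =>
    orbit_subset_bigCell _ _ ((richardson_eq u v).subset hF).1
  have h2 : richardson v w ⊆ bigCell v := fun F hF =>
    orbit_subset_bigCell _ _ ((richardson_eq v w).subset hF).2
  refine ⟨spliceEquiv u v w, FunSpace.IsMorphism.prodMk ?_ ?_, ?_⟩
  · have hU := (subvariety (splicingSet u v w)).top.isOpen_univ
    refine isMorphism_subvariety (M := fun F => spliceFst v F.1 * permGL v) (fun F => rfl) ?_
    exact ((isRegMatrix_cellRep v hS).luRest hU fun F _ =>
      leadProd_ne_zero_of_mem_tri (cellRep_mem v F.1).1).mul_gl (FunSpace.isRegMatrix_const _)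
  · have hU := (subvariety (splicingSet u v w)).top.isOpen_univ
    refine isMorphism_subvariety (M := fun F => spliceSnd v F.1 * permGL v) (fun F => rfl) ?_
    exact ((((isRegMatrix_cellRep v hS).inv_gl hU).luLower hU fun F _ =>
      leadProd_ne_zero_of_mem_tri (inv_mem (cellRep_mem v F.1)).1).inv_gl hU).mul_gl
        (FunSpace.isRegMatrix_const _)
  · have hU := ((subvariety (richardson u v)).prod (subvariety (richardson v w))).top.isOpen_univ
    have hA := (isRegMatrix_cellRep v h1).comp
      (FunSpace.isMorphism_fst (subvariety (richardson u v)) (subvariety (richardson v w)))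
    have hB := (isRegMatrix_cellRep v h2).comp
      (FunSpace.isMorphism_snd (subvariety (richardson u v)) (subvariety (richardson v w)))
    refine isMorphism_subvariety (M := fun z => unsplice v z.1.1 z.2.1 * permGL v)
      (fun z => rfl) ?_
    exact (((hA.mul_gl (hB.inv_gl hU)).luRest hU fun z _ => leadProd_ne_zero_of_mem_tri
      (mul_mem (cellRep_mem v z.1.1) (inv_mem (cellRep_mem v z.2.1))).1).mul_gl hB).mul_gl
        (FunSpace.isRegMatrix_const _)

theorem isPrincipalOpen_splicingSet (u v w : Equiv.Perm (Fin k)) :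
    (subvariety (richardson u w)).IsPrincipalOpen {F | F.1 ∈ splicingSet u v w} := by
  have hw : richardson u w ⊆ bigCell w := fun F hF =>
    orbit_subset_bigCell _ _ ((richardson_eq u w).subset hF).1
  -- The cell at `F(w)` contains all of `R(u, w)`, so its representative gives one global regular
  -- lift, on which the minors for `v` can be evaluated.
  refine ⟨fun F => leadProd (((permGL v)⁻¹ * (cellRep w F.1 * permGL w) : GL (Fin k) ℂ) :
    Matrix (Fin k) (Fin k) ℂ), ?_, ?_⟩
  · exact ((FunSpace.isRegMatrix_const _).mul_gl
      ((isRegMatrix_cellRep w hw).mul_gl (FunSpace.isRegMatrix_const _))).leadProd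
  · ext F
    simp only [Set.mem_ofPred_eq, splicingSet_eq]
    rw [← ofMatrix_mem_bigCell, ofMatrix_cellRep (hw F.2)]
    exact and_iff_right F.2

theorem bruhatLE_of_splicingSet_nonempty (h : (splicingSet u v w).Nonempty) :
    BruhatLE u v ∧ BruhatLE v w :=
  ⟨bruhatLE_of_mem_richardson (ofMatrix_spliceFst_mem h.some_mem),
    bruhatLE_of_mem_richardson (ofMatrix_spliceSnd_mem h.some_mem)⟩

end CFlag

end SplicedFlags

end

theorem theorem1p4 (k : ℕ) :
    (∀ u v w : Equiv.Perm (Fin k),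
      SplicedFlags.BruhatLE u v → SplicedFlags.BruhatLE v w →
        (SplicedFlags.CFlag.subvariety (SplicedFlags.CFlag.richardson u w)).IsPrincipalOpen
            {F | F.1 ∈ SplicedFlags.CFlag.splicingSet u v w} ∧
          (SplicedFlags.CFlag.subvariety (SplicedFlags.CFlag.splicingSet u v w)).Isomorphic
            ((SplicedFlags.CFlag.subvariety (SplicedFlags.CFlag.richardson u v)).prod
              (SplicedFlags.CFlag.subvariety (SplicedFlags.CFlag.richardson v w)))) ∧
    (∀ u v w : Equiv.Perm (Fin k),
      (SplicedFlags.CFlag.splicingSet u v w).Nonempty →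
        SplicedFlags.BruhatLE u v ∧ SplicedFlags.BruhatLE v w) := by
  exact ⟨fun u v w _ _ => ⟨SplicedFlags.CFlag.isPrincipalOpen_splicingSet u v w,
    SplicedFlags.CFlag.isomorphic_splicingSet u v w⟩,
    fun u v w h => SplicedFlags.CFlag.bruhatLE_of_splicingSet_nonempty h⟩
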